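/- Let $\mathcal H$ be a real Hilbert space and $f:\mathcal H\to\mathbb R\cup\{+\infty\}$ a proper, convex, lower semicontinuous function with $\operatorname{argmin} f\neq\emptyset$; let $x^*$ be the element of minimal norm of $\operatorname{argmin} f$. Let $\alpha,c>0$, $0<q<1$ and $1<p<q+1$, and for $k\ge 1$ put $\alpha_k=1-\frac{\alpha}{k^q}$, $c_k=\frac{c}{k^p}$ and $f_k(z)=f(z)+\frac{c}{2k^p}\|z\|^2$; let $\bar x_k$ be the unique minimizer of $f_k$ over $\mathcal H$. For arbitrary starting points $x_0,x_1\in\mathcal H$ let $(x_k)$ be generated by $$x_{k+1}=\operatorname{prox}_{f}\bigl(x_k+\alpha_k(x_k-x_{k-1})-c_kx_k\bigr),\qquad k\ge 1,$$ where $\operatorname{prox}_f(w)=\operatorname{argmin}_{z\in\mathcal H}\bigl(f(z)+\tfrac12\|z-w\|^2\bigr)$ (the stepsize is $\lambda_k\equiv 1$). For $k\ge 2$ define $u_k$ by $$x_k=\alpha_{k-1}(x_{k-1}-x_{k-2})-u_k+(1-c_{k-1})x_{k-1}.$$ Then $f(x_k)<+\infty$ and $u_k\in\partial f(x_k)$ for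 all $k\ge 2$, and $\lim_{n\to\infty}\|x_n-x^*\|=0$. Moreover, as $n\to+\infty$: (i) If $p\le 2q$, then $\|x_n-\bar x_n\|=\mathcal O\bigl(n^{\frac{q-1}{2}}\bigr)$, $\ \|x_n-x_{n-1}\|^2,\ \|u_n\|^2\in\mathcal O(n^{q-p-1})$ and $f(x_n)-\min f=\mathcal O(n^{-p})$. (ii) If $2q<p\le\frac{3q+1}{2}$, then $\|x_n-\bar x_n\|=\mathcal O\bigl(n^{\frac{q-1}{2}}\bigr)$, $\ f_n(x_n)-f_n(\bar x_n),\ \|x_n-x_{n-1}\|^2,\ \|u_n\|^2\in\mathcal O(n^{-q-1})$ and $f(x_n)-\min f=\mathcal O(n^{-p})$. (iii) If $\frac{3q+1}{2}<p<q+1$, then $\|x_n-\bar x_n\|=\mathcal O(n^{p-q-1})$ and $f_n(x_n)-f_n(\bar x_n),\ \|x_n-x_{n-1}\|^2,\ \|u_n\|^2\in\mathcal O(n^{2p-4q-2})$. In addition, $f(x_n)-\min f=\mathcal O(n^{-p})$ if $\frac{3q+1}{2}<p<\frac{4q+2}{3}$, and $f(x_n)-\min f=\mathcal O(n^{2p-4q-2})$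 if $\frac{4q+2}{3}\le p<q+1$. Finally, in cases (ii) and (iii), that is whenever $p>2q$, $$\sum_{k=2}^{\infty}k^q\bigl(f_k(x_k)-f_k(\bar x_k)\bigr)<+\infty,\qquad \sum_{k=2}^{\infty}k^{2q}\|u_k\|^2<+\infty,\qquad \sum_{k=1}^{\infty}k^q\|x_{k+1}-x_k\|^2<+\infty.$$ -/

import Mathlib

open Filter Asymptotics
open scoped Topology

noncomputable section

/-- Proper convex lower semicontinuous functions `f : H → ℝ ∪ {+∞}`, modelled as `EReal`-valued
functions that never take the value `-∞`. -/
structure ProperConvexLsc {H : Type*} [NormedAddCommGroup H] [InnerProductSpace ℝ H]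
    (f : H → EReal) : Prop where
  ne_bot : ∀ y, f y ≠ ⊥
  proper : ∃ y, f y ≠ ⊤
  convex : ∀ y z : H, ∀ a b : ℝ, 0 ≤ a → 0 ≤ b → a + b = 1 →
    f (a • y + b • z) ≤ (a : EReal) * f y + (b : EReal) * f z
  lsc : LowerSemicontinuous f

/-- The set of global minimizers of `g`. -/
def argminSet {H : Type*} (g : H → EReal) : Set H :=
  {y | ∀ z, g y ≤ g z}

/-- `y` is a minimizer of `g` of minimal norm. -/
def IsMinNormMinimizer {H : Type*} [NormedAddCommGroup H] (g : H → EReal) (y : H) : Prop :=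
  y ∈ argminSet g ∧ ∀ z ∈ argminSet g, ‖y‖ ≤ ‖z‖

/-- The set of minimizers of `z ↦ f z + ‖z - w‖² / (2 s)`; for `s > 0` and `f` proper, convex and
lower semicontinuous it is the singleton whose only element is the proximal point
`prox_{s f} w`. -/
def proxSet {H : Type*} [NormedAddCommGroup H] (s : ℝ) (f : H → EReal) (w : H) : Set H :=
  argminSet fun z => f z + ((1 / (2 * s) * ‖z - w‖ ^ 2 : ℝ) : EReal)

/-- The convex subdifferential `∂f(y)`. It is empty where a proper `f` takes the value `+∞`. -/
def subdiff {H : Type*} [NormedAddCommGroup H] [InnerProductSpace ℝ H]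
    (f : H → EReal) (y : H) : Set H :=
  {u | ∀ z, f y + ((inner ℝ u (z - y) : ℝ) : EReal) ≤ f z}

/-- The inertial (extrapolation) parameter `1 - α / k ^ q`. -/
def inertialCoeff (α q : ℝ) (k : ℕ) : ℝ := 1 - α / (k : ℝ) ^ q

/-- The Tikhonov regularization parameter `c / k ^ p`. -/
def tikhonovCoeff (c p : ℝ) (k : ℕ) : ℝ := c / (k : ℝ) ^ p

/-- The regularized objective `z ↦ f z + (c / (2 k ^ p)) ‖z‖²`. -/
def tikhonovReg {H : Type*} [NormedAddCommGroup H] (f : H → EReal) (c p : ℝ) (k : ℕ) (z : H) :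
    EReal :=
  f z + ((tikhonovCoeff c p k / 2 * ‖z‖ ^ 2 : ℝ) : EReal)

/-- `x` is generated by the proximal inertial algorithm with Tikhonov regularization and
stepsizes `lam k`, from the arbitrary starting points `x 0`, `x 1`. -/
def IsPIATR {H : Type*} [NormedAddCommGroup H] [InnerProductSpace ℝ H]
    (f : H → EReal) (α q c p : ℝ) (lam : ℕ → ℝ) (x : ℕ → H) : Prop :=
  ∀ k : ℕ, 1 ≤ k →
    x (k + 1) ∈ proxSet (lam k) f
      (x k + inertialCoeff α q k • (x k - x (k - 1)) - tikhonovCoeff c p k • x k)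

end

/-!
Convergence of an inertial proximal algorithm with Tikhonov regularization.

Write `τ = k ^ q`, `γ = c / k ^ p`, `a = α / 2`, `f_k = f + γ / 2 ‖·‖²` with minimizer `xbar k`, and
`y = x k - xbar k`, `v = x k - x (k - 1)`. The proximal step says that
`w = u (k + 1) + γ x (k + 1)` is a subgradient of the strongly convex `f_k` at `x (k + 1)`, and that
`(1 - γ) (x (k + 1) - x k) = (1 - α / τ) v - w`: a discretized heavy ball with damping `α / k ^ q`
for an objective with modulus of convexity `c / k ^ p`. Its Lyapunov function is
`V k = ‖a y + (τ - α) v‖² + a² ‖y‖² + 2 (τ (1 - γ) - a) τ (f_k (x k) - f_k (xbar k))`.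
The expansion of `V` with the subgradient inequalities at `xbar k` and at `x k`
(`inertialEnergy_descent_exact`) and the absorption of the error terms (`inertialEnergy_descent`)
show that, for large `k`, a step decreases `V` by a dissipation comparable to
`τ (f_{k+1} (x (k + 1)) - min f_{k+1}) + τ γ ‖y‖² + τ ‖v‖² + τ² ‖w‖²`, the first three terms
being taken at `k + 1`, up to two sources: the variation of `min f_k`, of order
`k ^ (2 q - p - 1)`, and the drift `‖xbar (k + 1) - xbar k‖ = O(1 / k)`, which costs
`k ^ (p - q - 2)` (`InertialTikhonovScheme.energy_estimate`).

The dissipation is at least of order `k ^ (-s) V` with `s = max q (p - q) < 1`. A sequence contracted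
at this speed with a source `k ^ (-r)` is `O(k ^ (s - r))` (`isBigO_rpow_of_contracting`). The three
regimes of the rates correspond to which of `q` and `p - q` and which of the two sources is the
larger. If `p > 2 q` both sources are summable, and telescoping gives the sum estimates. The Tikhonov
path `xbar` converges to the minimizer of minimal norm (`tendsto_tikhonov_path`), and therefore so
does `x`.
-/

/-! ### Powers of the index, and recurrences with a source term -/

lemma add_one_rpow_le {q x : ℝ} (hq0 : 0 ≤ q) (hq1 : q ≤ 1) (hx : 1 ≤ x) :
    (x + 1) ^ q ≤ x ^ q + x ^ q * (1 / x) := by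
  have hx0 : 0 < x := by linarith
  have h1 : x + 1 = x * (1 + 1 / x) := by field_simp
  have hix : 0 ≤ 1 / x := by positivity
  have h2 : (1 + 1 / x) ^ q ≤ 1 + q * (1 / x) :=
    rpow_one_add_le_one_add_mul_self (by linarith) hq0 hq1
  rw [h1, Real.mul_rpow hx0.le (by linarith)]
  have h3 : 0 ≤ x ^ q := Real.rpow_nonneg hx0.le q
  nlinarith [mul_le_mul_of_nonneg_right hq1 hix]

/-- Bernoulli's inequality for `(x + 1) ^ σ / x ^ σ`, covering exponents of either sign. -/
lemma rpow_mul_one_sub_le_add_one_rpow {σ m x : ℝ} (hm : 1 ≤ m) (hσ : -m ≤ σ) (hx : 0 < x) :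
    x ^ σ * (1 - m / x) ≤ (x + 1) ^ σ := by
  set t := x / (x + 1) with ht
  have ht0 : 0 < t := by positivity
  have ht1 : t ≤ 1 := by rw [ht, div_le_one (by linarith)]; linarith
  have hxt : x = t * (x + 1) := by rw [ht]; field_simp
  have h1 : 1 - m / x ≤ t ^ m := by
    have h := one_add_mul_self_le_rpow_one_add (s := t - 1) (by linarith) hm
    have e : t - 1 = -(1 / (x + 1)) := by rw [ht]; field_simp; ring
    have h3 : 1 / (x + 1) ≤ 1 / x := one_div_le_one_div_of_le hx (by linarith)
    have h4 : m / x = m * (1 / x) := by ring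
    rw [show 1 + (t - 1) = t by ring, e] at h
    nlinarith
  have h2 : t ^ σ * t ^ m ≤ 1 := by
    rw [← Real.rpow_add ht0]
    exact Real.rpow_le_one ht0.le ht1 (by linarith)
  have h3 : x ^ σ = t ^ σ * (x + 1) ^ σ := by
    conv_lhs => rw [hxt]
    rw [Real.mul_rpow ht0.le (by linarith)]
  have h4 : t ^ σ * (1 - m / x) ≤ 1 :=
    (mul_le_mul_of_nonneg_left h1 (Real.rpow_nonneg ht0.le σ)).trans h2
  calc x ^ σ * (1 - m / x) = t ^ σ * (1 - m / x) * (x + 1) ^ σ := by rw [h3]; ring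
    _ ≤ 1 * (x + 1) ^ σ := by gcongr
    _ = _ := one_mul _

lemma tendsto_natCast_rpow_neg {e : ℝ} (he : e < 0) :
    Tendsto (fun k : ℕ => (k : ℝ) ^ e) atTop (𝓝 0) := by
  have h := (tendsto_rpow_neg_atTop (y := -e) (by linarith)).comp
    (tendsto_natCast_atTop_atTop (R := ℝ))
  simpa [Function.comp_def] using h

lemma eventually_mul_natCast_rpow_le {e ε : ℝ} (A : ℝ) (he : e < 0) (hε : 0 < ε) :
    ∀ᶠ k : ℕ in atTop, A * (k : ℝ) ^ e ≤ ε := by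
  have h := (tendsto_natCast_rpow_neg he).const_mul A
  rw [mul_zero] at h
  exact h.eventually_le_const hε

/-- A nonnegative sequence which contracts at step `k` by a factor `1 + κ k ^ (-s)` with `s < 1`,
up to a source term of order `k ^ (σ - s)`, is of order `k ^ σ`. -/
theorem isBigO_rpow_of_contracting {V : ℕ → ℝ} {κ C s σ : ℝ} (hκ : 0 < κ) (hC : 0 ≤ C)
    (hs : s < 1) (hV : ∀ᶠ k in atTop, 0 ≤ V k)
    (hrec : ∀ᶠ k : ℕ in atTop,
      (1 + κ * (k : ℝ) ^ (-s)) * V (k + 1) ≤ V k + C * (k : ℝ) ^ (σ - s)) :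
    V =O[atTop] fun k : ℕ => (k : ℝ) ^ σ := by
  set m : ℝ := max 1 (-σ) with hm
  have hm1 : 1 ≤ m := le_max_left _ _
  have hmσ : -m ≤ σ := by have := le_max_right 1 (-σ); linarith
  have hsmall := eventually_mul_natCast_rpow_le (e := s - 1) (ε := κ / 4) m (by linarith)
    (by linarith)
  have hone := eventually_mul_natCast_rpow_le (e := -1) (ε := 1 / 4) m (by norm_num)
    (by norm_num)
  obtain ⟨K, hK⟩ := eventually_atTop.1
    (hV.and (hrec.and (hsmall.and (hone.and (eventually_ge_atTop 1)))))
  have hK1 : 1 ≤ K := (hK K le_rfl).2.2.2.2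
  have hKpos : (0 : ℝ) < K := by exact_mod_cast hK1
  set L : ℝ := max (2 * C / κ) (V K * (K : ℝ) ^ (-σ)) with hL
  have hLC : 2 * C ≤ L * κ := by
    have := le_max_left (2 * C / κ) (V K * (K : ℝ) ^ (-σ))
    rwa [div_le_iff₀ hκ] at this
  have hL0 : 0 ≤ L := le_trans (by positivity) (le_max_left _ _)
  have key : ∀ k, K ≤ k → V k ≤ L * (k : ℝ) ^ σ := by
    intro k hk
    induction k, hk using Nat.le_induction with
    | base =>
      have h1 := le_max_right (2 * C / κ) (V K * (K : ℝ) ^ (-σ))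
      calc V K = V K * (K : ℝ) ^ (-σ) * (K : ℝ) ^ σ := by
            rw [mul_assoc, ← Real.rpow_add hKpos]; simp
        _ ≤ L * (K : ℝ) ^ σ := by gcongr
    | succ k hk ih =>
      obtain ⟨-, hr, hsm, hon, hk1⟩ := hK k hk
      have hk0 : (0 : ℝ) < k := by exact_mod_cast hk1
      set T : ℝ := (k : ℝ) ^ (-s) with hT
      have hT0 : 0 < T := Real.rpow_pos_of_pos hk0 _
      have hX0 : 0 < (k : ℝ) ^ σ := Real.rpow_pos_of_pos hk0 _
      set μ : ℝ := m / k with hμ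
      have hμ1 : μ ≤ 1 / 4 := by
        rw [Real.rpow_neg_one] at hon; exact hon
      have hμ0 : 0 ≤ μ := by positivity
      have hμ2 : μ ≤ κ / 4 * T := by
        have e1 : (k : ℝ) ^ (s - 1) * T = (k : ℝ)⁻¹ := by
          rw [hT, ← Real.rpow_add hk0, ← Real.rpow_neg_one]; congr 1; ring
        calc μ = m * (k : ℝ) ^ (s - 1) * T := by rw [mul_assoc, e1]; rfl
          _ ≤ _ := by gcongr
      have hsrc : C * (k : ℝ) ^ (σ - s) = C * (k : ℝ) ^ σ * T := by
        rw [sub_eq_add_neg, Real.rpow_add hk0, mul_assoc]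
      have hB := rpow_mul_one_sub_le_add_one_rpow hm1 hmσ hk0
      rw [hsrc] at hr
      have hfac : 1 + κ / 2 * T ≤ (1 + κ * T) * (1 - μ) := by
        nlinarith [mul_le_mul_of_nonneg_left hμ1 (mul_pos hκ hT0).le]
      have hpos : 0 < 1 + κ * T := by positivity
      push_cast
      refine le_of_mul_le_mul_left ?_ hpos
      calc (1 + κ * T) * V (k + 1) ≤ V k + C * (k : ℝ) ^ σ * T := hr
        _ ≤ L * (k : ℝ) ^ σ + (L * κ / 2) * (k : ℝ) ^ σ * T := by
            gcongr; linarith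
        _ = L * (k : ℝ) ^ σ * (1 + κ / 2 * T) := by ring
        _ ≤ L * (k : ℝ) ^ σ * ((1 + κ * T) * (1 - μ)) := by gcongr
        _ = (1 + κ * T) * (L * ((k : ℝ) ^ σ * (1 - μ))) := by ring
        _ ≤ (1 + κ * T) * (L * ((k : ℝ) + 1) ^ σ) := by gcongr
  refine IsBigO.of_bound L ?_
  filter_upwards [eventually_ge_atTop K] with k hk
  rw [Real.norm_of_nonneg (hK k hk).1, Real.norm_of_nonneg (by positivity)]
  exact key k hk

/-- Telescoping: a dissipation term controlled by the decrease of a nonnegative energy, up to a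
summable source, is summable. -/
theorem summable_of_energy_decrease {V D R : ℕ → ℝ} (hV : ∀ᶠ k in atTop, 0 ≤ V k)
    (hD : ∀ᶠ k in atTop, 0 ≤ D k) (hR : Summable R)
    (h : ∀ᶠ k in atTop, V (k + 1) + D k ≤ V k + R k) : Summable D := by
  obtain ⟨K, hK⟩ := eventually_atTop.1 (hV.and (hD.and h))
  rw [← summable_nat_add_iff K]
  have hR' : Summable fun k => |R (k + K)| := ((summable_nat_add_iff K).2 hR).abs
  refine summable_of_sum_range_le (c := V K + ∑' k, |R (k + K)|)
    (fun n => (hK (n + K) (by omega)).2.1) fun n => ?_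
  have key : V (n + K) + ∑ i ∈ Finset.range n, D (i + K)
      ≤ V K + ∑ i ∈ Finset.range n, |R (i + K)| := by
    induction n with
    | zero => simp
    | succ n ih =>
      have h1 := (hK (n + K) (by omega)).2.2
      rw [Finset.sum_range_succ, Finset.sum_range_succ, show n + 1 + K = n + K + 1 by ring]
      have := le_abs_self (R (n + K))
      linarith
  have h2 := hR'.sum_le_tsum (Finset.range n) (fun i _ => abs_nonneg _)
  have h3 := (hK (n + K) (by omega)).1
  linarith

/-! ### Subgradients and the Tikhonov path -/

section

variable {H : Type*} [NormedAddCommGroup H] [InnerProductSpace ℝ H]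

lemma ne_top_of_mem_argminSet_add_coe {f : H → EReal} (hf : ProperConvexLsc f) {r : H → ℝ} {y : H}
    (hy : y ∈ argminSet fun z => f z + (r z : EReal)) : f y ≠ ⊤ := by
  obtain ⟨z, hz⟩ := hf.proper
  intro h
  have h1 := hy z
  simp only [h, EReal.top_add_coe, top_le_iff] at h1
  exact EReal.add_ne_top hz (EReal.coe_ne_top _) h1

lemma ProperConvexLsc.toReal_convex {f : H → EReal} (hf : ProperConvexLsc f) {y z : H}
    (hy : f y ≠ ⊤) (hz : f z ≠ ⊤) {t : ℝ} (ht0 : 0 ≤ t) (ht1 : t ≤ 1) :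
    f (y + t • (z - y)) ≠ ⊤ ∧
      (f (y + t • (z - y))).toReal ≤ (1 - t) * (f y).toReal + t * (f z).toReal := by
  have h := hf.convex y z (1 - t) t (by linarith) ht0 (by ring)
  rw [show (1 - t) • y + t • z = y + t • (z - y) by module,
    ← EReal.coe_toReal hy (hf.ne_bot y), ← EReal.coe_toReal hz (hf.ne_bot z)] at h
  norm_cast at h
  have hne : f (y + t • (z - y)) ≠ ⊤ := ne_top_of_le_ne_top (EReal.coe_ne_top _) h
  refine ⟨hne, ?_⟩
  rw [← EReal.coe_toReal hne (hf.ne_bot _)] at h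
  exact_mod_cast h

/-- Fermat's rule for `f` plus a quadratic: if `y` minimizes `z ↦ f z + m / 2 * ‖z - w‖ ^ 2`, then
`m • (w - y)` is a subgradient of `f` at `y`. -/
theorem smul_sub_mem_subdiff_of_mem_argminSet {f : H → EReal} (hf : ProperConvexLsc f) {m : ℝ}
    {w y : H}
    (hy : y ∈ argminSet fun z => f z + ((m / 2 * ‖z - w‖ ^ 2 : ℝ) : EReal)) :
    m • (w - y) ∈ subdiff f y := by
  have hyt : f y ≠ ⊤ := ne_top_of_mem_argminSet_add_coe hf hy
  intro z
  by_cases hz : f z = ⊤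
  · rw [hz]; exact le_top
  have key : ∀ t : ℝ, 0 < t → t ≤ 1 →
      (f y).toReal + m * inner ℝ (w - y) (z - y) ≤ (f z).toReal + t * (m / 2 * ‖z - y‖ ^ 2) := by
    intro t ht0 ht1
    obtain ⟨h1, h2⟩ := hf.toReal_convex hyt hz ht0.le ht1
    have h3 := hy (y + t • (z - y))
    simp only at h3
    rw [← EReal.coe_toReal hyt (hf.ne_bot y), ← EReal.coe_toReal h1 (hf.ne_bot _)] at h3
    norm_cast at h3
    have h4 : ‖y + t • (z - y) - w‖ ^ 2
        = ‖y - w‖ ^ 2 - 2 * t * inner ℝ (w - y) (z - y) + t ^ 2 * ‖z - y‖ ^ 2 := by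
      rw [show y + t • (z - y) - w = (y - w) + t • (z - y) by abel, norm_add_sq_real,
        inner_smul_right, norm_smul, mul_pow, Real.norm_eq_abs, sq_abs,
        show y - w = -(w - y) by abel, inner_neg_left]
      ring
    rw [h4] at h3
    have h5 : t * ((f y).toReal + m * inner ℝ (w - y) (z - y))
        ≤ t * ((f z).toReal + t * (m / 2 * ‖z - y‖ ^ 2)) := by nlinarith
    exact le_of_mul_le_mul_left h5 ht0
  have hlim : Tendsto (fun t : ℝ => (f z).toReal + t * (m / 2 * ‖z - y‖ ^ 2)) (𝓝[>] 0)
      (𝓝 ((f z).toReal)) := by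
    have : Tendsto (fun t : ℝ => (f z).toReal + t * (m / 2 * ‖z - y‖ ^ 2)) (𝓝 0)
        (𝓝 ((f z).toReal + 0 * (m / 2 * ‖z - y‖ ^ 2))) :=
      (Continuous.tendsto (by fun_prop) 0)
    rw [zero_mul, add_zero] at this
    exact this.mono_left nhdsWithin_le_nhds
  have hfin := ge_of_tendsto hlim (b := (f y).toReal + m * inner ℝ (w - y) (z - y)) (by
    filter_upwards [Ioc_mem_nhdsGT (zero_lt_one (α := ℝ))] with t ht
    exact key t ht.1 ht.2)
  rw [real_inner_smul_left, ← EReal.coe_toReal hyt (hf.ne_bot y),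
    ← EReal.coe_toReal hz (hf.ne_bot z)]
  exact_mod_cast hfin

lemma toReal_add_inner_le_of_mem_subdiff {f : H → EReal} (hf : ProperConvexLsc f) {u y z : H}
    (hu : u ∈ subdiff f y) (hy : f y ≠ ⊤) (hz : f z ≠ ⊤) :
    (f y).toReal + inner ℝ u (z - y) ≤ (f z).toReal := by
  have h := hu z
  rw [← EReal.coe_toReal hy (hf.ne_bot y), ← EReal.coe_toReal hz (hf.ne_bot z)] at h
  exact_mod_cast h

lemma toReal_tikhonovReg {f : H → EReal} (hf : ProperConvexLsc f) (c p : ℝ) (k : ℕ) {z : H}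
    (hz : f z ≠ ⊤) :
    (tikhonovReg f c p k z).toReal = (f z).toReal + tikhonovCoeff c p k / 2 * ‖z‖ ^ 2 := by
  rw [tikhonovReg, EReal.toReal_add hz (hf.ne_bot z) (EReal.coe_ne_top _) (EReal.coe_ne_bot _),
    EReal.toReal_coe]

lemma ne_top_of_mem_argminSet {f : H → EReal} (hf : ProperConvexLsc f) {y : H}
    (hy : y ∈ argminSet f) : f y ≠ ⊤ := by
  obtain ⟨z, hz⟩ := hf.proper
  exact ne_top_of_le_ne_top hz (hy z)

/-- The regularized minimizer `xbar k` satisfies `-c_k • xbar k ∈ ∂f (xbar k)`, and so the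
subgradient inequality below, on the domain of `f`. -/
lemma tikhonov_subgradient_inequality {f : H → EReal} (hf : ProperConvexLsc f) {c p : ℝ} {k : ℕ}
    {y z : H} (hy : y ∈ argminSet (tikhonovReg f c p k)) (hz : f z ≠ ⊤) :
    (f y).toReal - tikhonovCoeff c p k * inner ℝ y (z - y) ≤ (f z).toReal := by
  have h := smul_sub_mem_subdiff_of_mem_argminSet hf (m := tikhonovCoeff c p k) (w := 0) (y := y)
    (by
      have e : tikhonovReg f c p k
          = fun z => f z + ((tikhonovCoeff c p k / 2 * ‖z - 0‖ ^ 2 : ℝ) : EReal) := by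
        funext z; rw [tikhonovReg, sub_zero]
      rwa [← e])
  have := toReal_add_inner_le_of_mem_subdiff hf h (ne_top_of_mem_argminSet_add_coe hf hy) hz
  rw [zero_sub, real_inner_smul_left, inner_neg_left] at this
  linarith

lemma tikhonovCoeff_pos {c p : ℝ} (hc : 0 < c) {k : ℕ} (hk : 1 ≤ k) : 0 < tikhonovCoeff c p k := by
  have : (0 : ℝ) < k := by exact_mod_cast hk
  unfold tikhonovCoeff
  positivity

lemma tikhonovCoeff_eq (c p : ℝ) (k : ℕ) : tikhonovCoeff c p k = c * (k : ℝ) ^ (-p) := by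
  rw [tikhonovCoeff, Real.rpow_neg (Nat.cast_nonneg k), div_eq_mul_inv]

lemma tikhonovCoeff_anti {c p : ℝ} (hc : 0 < c) (hp : 0 ≤ p) {j k : ℕ} (hj : 1 ≤ j) (hjk : j ≤ k) :
    tikhonovCoeff c p k ≤ tikhonovCoeff c p j := by
  have : (0 : ℝ) < j := by exact_mod_cast hj
  unfold tikhonovCoeff
  gcongr

lemma tikhonovCoeff_sub_le {c p : ℝ} (hc : 0 < c) (hp : 1 ≤ p) {k : ℕ} (hk : 1 ≤ k) :
    tikhonovCoeff c p k - tikhonovCoeff c p (k + 1) ≤ p / k * tikhonovCoeff c p k := by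
  have hk0 : (0 : ℝ) < k := by exact_mod_cast hk
  have h := rpow_mul_one_sub_le_add_one_rpow hp (le_refl (-p)) hk0
  rw [tikhonovCoeff_eq, tikhonovCoeff_eq]
  push_cast
  nlinarith

lemma inner_tikhonov_minimizer_nonneg {f : H → EReal} (hf : ProperConvexLsc f) {c p : ℝ}
    (hc : 0 < c) {k : ℕ} (hk : 1 ≤ k) {y xstar : H} (hy : y ∈ argminSet (tikhonovReg f c p k))
    (hx : xstar ∈ argminSet f) : 0 ≤ inner ℝ y (xstar - y) := by
  have hyt := ne_top_of_mem_argminSet_add_coe hf hy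
  have hxt := ne_top_of_mem_argminSet hf hx
  have h1 := tikhonov_subgradient_inequality hf hy hxt
  have h2 := EReal.toReal_le_toReal (hx y) (hf.ne_bot _) hyt
  have hc' := tikhonovCoeff_pos (p := p) hc hk
  by_contra hcon
  push Not at hcon
  nlinarith

lemma norm_tikhonov_minimizer_le {f : H → EReal} (hf : ProperConvexLsc f) {c p : ℝ} (hc : 0 < c)
    {k : ℕ} (hk : 1 ≤ k) {y xstar : H} (hy : y ∈ argminSet (tikhonovReg f c p k))
    (hx : xstar ∈ argminSet f) : ‖y‖ ≤ ‖xstar‖ := by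
  have h3 := inner_tikhonov_minimizer_nonneg hf hc hk hy hx
  rw [inner_sub_right, real_inner_self_eq_norm_sq] at h3
  have h4 := real_inner_le_norm y xstar
  by_contra hcon
  push Not at hcon
  nlinarith [norm_nonneg xstar, norm_nonneg y]

/-- Monotonicity of `∂f` along the Tikhonov path. -/
lemma tikhonov_path_monotone {f : H → EReal} (hf : ProperConvexLsc f) {c p : ℝ} {j k : ℕ} {y z : H}
    (hy : y ∈ argminSet (tikhonovReg f c p j)) (hz : z ∈ argminSet (tikhonovReg f c p k)) :
    tikhonovCoeff c p k * inner ℝ z (z - y) ≤ tikhonovCoeff c p j * inner ℝ y (z - y) := by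
  have h1 := tikhonov_subgradient_inequality hf hy (ne_top_of_mem_argminSet_add_coe hf hz)
  have h2 := tikhonov_subgradient_inequality hf hz (ne_top_of_mem_argminSet_add_coe hf hy)
  rw [show y - z = -(z - y) by abel, inner_neg_right] at h2
  linarith

lemma norm_tikhonov_step_le {f : H → EReal} (hf : ProperConvexLsc f) {c p : ℝ} (hc : 0 < c)
    (hp : 1 ≤ p) {k : ℕ} (hk : 1 ≤ k) {y z xstar : H}
    (hy : y ∈ argminSet (tikhonovReg f c p k)) (hz : z ∈ argminSet (tikhonovReg f c p (k + 1)))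
    (hx : xstar ∈ argminSet f) : ‖z - y‖ ≤ p * ‖xstar‖ * (1 / k) := by
  have h1 := tikhonov_path_monotone hf hy hz
  have hzn := norm_tikhonov_minimizer_le hf hc (by omega) hz hx
  have hck := tikhonovCoeff_pos (p := p) hc hk
  have hanti := tikhonovCoeff_anti hc (p := p) (by linarith) hk (Nat.le_succ k)
  have hdiff := tikhonovCoeff_sub_le hc hp hk
  set γ := tikhonovCoeff c p k
  set γ' := tikhonovCoeff c p (k + 1)
  have h2 : γ * ‖z - y‖ ^ 2 ≤ (γ - γ') * inner ℝ z (z - y) := by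
    have : ‖z - y‖ ^ 2 = inner ℝ z (z - y) - inner ℝ y (z - y) := by
      rw [← inner_sub_left, real_inner_self_eq_norm_sq]
    rw [this]
    linarith
  have h3 : (γ - γ') * inner ℝ z (z - y) ≤ (p / k * γ) * (‖xstar‖ * ‖z - y‖) := by
    have h0 : 0 ≤ γ - γ' := by linarith
    calc (γ - γ') * inner ℝ z (z - y) ≤ (γ - γ') * (‖z‖ * ‖z - y‖) := by
          gcongr; exact real_inner_le_norm _ _
      _ ≤ (p / k * γ) * (‖xstar‖ * ‖z - y‖) := by gcongr
  have h4 : ‖z - y‖ * (γ * ‖z - y‖) ≤ ‖z - y‖ * (γ * (p * ‖xstar‖ * (1 / k))) := by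
    calc _ = γ * ‖z - y‖ ^ 2 := by ring
      _ ≤ _ := h2.trans h3
      _ = _ := by ring
  rcases (norm_nonneg (z - y)).eq_or_lt with h | h
  · rw [← h]; positivity
  · exact le_of_mul_le_mul_left (le_of_mul_le_mul_left h4 h) hck

/-- Convergence of the Tikhonov path to the minimizer of minimal norm. Along the path
`‖xbar k - xbar j‖ ^ 2 ≤ ‖xbar k‖ ^ 2 - ‖xbar j‖ ^ 2` for `j ≤ k`, and the norms are bounded by
`‖xstar‖`; hence the path is Cauchy, without any use of weak compactness. -/
theorem tendsto_tikhonov_path [CompleteSpace H] {f : H → EReal} (hf : ProperConvexLsc f) {c p : ℝ}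
    (hc : 0 < c) (hp : 0 < p) {xstar : H} (hxstar : IsMinNormMinimizer f xstar) {xbar : ℕ → H}
    (hxbar : ∀ k : ℕ, 1 ≤ k → xbar k ∈ argminSet (tikhonovReg f c p k)) :
    Tendsto xbar atTop (𝓝 xstar) := by
  have hxt := ne_top_of_mem_argminSet hf hxstar.1
  have hle : ∀ k, 1 ≤ k → ‖xbar k‖ ≤ ‖xstar‖ := fun k hk =>
    norm_tikhonov_minimizer_le hf hc hk (hxbar k hk) hxstar.1
  have hstep : ∀ j k, 1 ≤ j → j ≤ k →
      ‖xbar k - xbar j‖ ^ 2 ≤ ‖xbar k‖ ^ 2 - ‖xbar j‖ ^ 2 := by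
    intro j k hj hjk
    have h1 := tikhonov_path_monotone hf (hxbar j hj) (hxbar k (hj.trans hjk))
    have h2 := tikhonovCoeff_anti hc hp.le hj hjk
    have h3 := tikhonovCoeff_pos (p := p) hc (hj.trans hjk)
    set A := xbar j
    set B := xbar k
    have e1 : inner ℝ B (B - A) = inner ℝ A (B - A) + ‖B - A‖ ^ 2 := by
      rw [← real_inner_self_eq_norm_sq, ← inner_add_left]; congr 1; abel
    have e2 : ‖B‖ ^ 2 = ‖A‖ ^ 2 + 2 * inner ℝ A (B - A) + ‖B - A‖ ^ 2 := by
      rw [← norm_add_sq_real]; congr 2; abel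
    rw [e1] at h1
    have h4 : 0 ≤ inner ℝ A (B - A) := by
      by_contra hcon
      push Not at hcon
      have hd : ‖B - A‖ ^ 2 ≤ 0 := by nlinarith
      have hBA : B - A = 0 := by
        rw [← norm_eq_zero]
        nlinarith [norm_nonneg (B - A)]
      rw [hBA, inner_zero_right] at hcon
      exact lt_irrefl _ hcon
    linarith
  -- the squared norms are monotone and bounded, hence Cauchy
  have hmono : Monotone fun n : ℕ => ‖xbar (n + 1)‖ ^ 2 := by
    refine monotone_nat_of_le_succ fun n => ?_
    have := hstep (n + 1) (n + 1 + 1) (by omega) (by omega)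
    nlinarith [sq_nonneg ‖xbar (n + 1 + 1) - xbar (n + 1)‖]
  have hbdd : BddAbove (Set.range fun n : ℕ => ‖xbar (n + 1)‖ ^ 2) := by
    refine ⟨‖xstar‖ ^ 2, ?_⟩
    rintro _ ⟨n, rfl⟩
    have := hle (n + 1) (by omega)
    simp only
    gcongr
  have hcauchyN : CauchySeq fun n : ℕ => ‖xbar (n + 1)‖ ^ 2 :=
    (tendsto_atTop_ciSup hmono hbdd).cauchySeq
  have hcauchy : CauchySeq fun n : ℕ => xbar (n + 1) := by
    rw [Metric.cauchySeq_iff'] at hcauchyN ⊢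
    intro ε hε
    obtain ⟨N, hN⟩ := hcauchyN (ε ^ 2) (by positivity)
    refine ⟨N, fun n hn => ?_⟩
    have h1 := hN n hn
    have h2 := hstep (N + 1) (n + 1) (by omega) (by omega)
    rw [Real.dist_eq] at h1
    have h3 := lt_of_le_of_lt (h2.trans (le_abs_self _)) h1
    rw [dist_eq_norm]
    exact lt_of_pow_lt_pow_left₀ 2 hε.le h3
  obtain ⟨l, hl⟩ := cauchySeq_tendsto_of_complete hcauchy
  have hnl : ‖l‖ ≤ ‖xstar‖ := by
    refine le_of_tendsto hl.norm (Eventually.of_forall fun n => hle (n + 1) (by omega))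
  -- `l` is a minimizer by lower semicontinuity
  have hlim : l ∈ argminSet f := by
    have hlx : f l ≤ f xstar := by
      refine le_of_forall_lt_imp_le_of_dense fun b hb => ?_
      have hev := hl.eventually (hf.lsc l b hb)
      have hcoef : Tendsto (fun n : ℕ => (f xstar).toReal
          + tikhonovCoeff c p (n + 1) / 2 * ‖xstar‖ ^ 2) atTop (𝓝 (f xstar).toReal) := by
        have h0 : Tendsto (fun n : ℕ => tikhonovCoeff c p (n + 1)) atTop (𝓝 0) := by
          have := ((tendsto_natCast_rpow_neg (e := -p) (by linarith)).const_mul c)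
          rw [mul_zero] at this
          simpa only [tikhonovCoeff_eq, Function.comp_def] using
            this.comp (tendsto_add_atTop_nat 1)
        have := ((h0.div_const 2).mul_const (‖xstar‖ ^ 2)).const_add (f xstar).toReal
        simpa using this
      have hle' : ∀ n : ℕ, f (xbar (n + 1)) ≤ (((f xstar).toReal
          + tikhonovCoeff c p (n + 1) / 2 * ‖xstar‖ ^ 2 : ℝ) : EReal) := by
        intro n
        have h := hxbar (n + 1) (by omega) xstar
        have hc' := tikhonovCoeff_pos (p := p) hc (k := n + 1) (by omega)
        have hyt := ne_top_of_mem_argminSet_add_coe hf (hxbar (n + 1) (by omega))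
        rw [tikhonovReg, tikhonovReg, ← EReal.coe_toReal hxt (hf.ne_bot _),
          ← EReal.coe_toReal hyt (hf.ne_bot _)] at h
        rw [← EReal.coe_toReal hyt (hf.ne_bot _)]
        norm_cast at h ⊢
        refine le_trans ?_ h
        have : 0 ≤ tikhonovCoeff c p (n + 1) / 2 * ‖xbar (n + 1)‖ ^ 2 := by positivity
        linarith
      have hb' : b ≤ (((f xstar).toReal : ℝ) : EReal) :=
        ge_of_tendsto (continuous_coe_real_ereal.continuousAt.tendsto.comp hcoef)
          (hev.mono fun n hn => (hn.le.trans (hle' n)))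
      rwa [EReal.coe_toReal hxt (hf.ne_bot _)] at hb'
    exact fun z => hlx.trans (hxstar.1 z)
  have heq : l = xstar := by
    have h1 : 0 ≤ inner ℝ l (xstar - l) :=
      ge_of_tendsto (hl.inner (hl.const_sub xstar)) (Eventually.of_forall fun n =>
        inner_tikhonov_minimizer_nonneg hf hc (by omega) (hxbar (n + 1) (by omega)) hxstar.1)
    have h2 := hxstar.2 l hlim
    have h3 : ‖xstar‖ ^ 2 = ‖l‖ ^ 2 + 2 * inner ℝ l (xstar - l) + ‖xstar - l‖ ^ 2 := by
      rw [← norm_add_sq_real]; congr 2; abel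
    have h4 : ‖xstar - l‖ = 0 := by
      nlinarith [norm_nonneg (xstar - l), norm_nonneg xstar]
    exact (sub_eq_zero.1 (norm_eq_zero.1 h4)).symm
  rw [heq] at hl
  exact (tendsto_add_atTop_iff_nat 1).1 hl

end

/-! ### The Lyapunov function of one inertial step -/

section

variable {H : Type*} [NormedAddCommGroup H] [InnerProductSpace ℝ H]

/-- The Lyapunov function of the inertial scheme, with `τ = k ^ q`, `γ` the Tikhonov parameter,
`g` the gap `f_k (x k) - f_k (xbar k)`, `y = x k - xbar k` and `v = x k - x (k - 1)`; the constant
`a` is half of the damping parameter `α`. -/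
noncomputable def inertialEnergy (a τ γ g : ℝ) (y v : H) : ℝ :=
  ‖a • y + (τ - 2 * a) • v‖ ^ 2 + a ^ 2 * ‖y‖ ^ 2 + 2 * (τ * (1 - γ) - a) * τ * g

lemma inertialEnergy_descent_exact {a τ τ' γ g G : ℝ} {y v v' w : H} (hτ : 0 ≤ τ)
    (hP : 0 ≤ τ * (1 - γ) - a)
    (hv : (τ - 2 * a) • v = τ • ((1 - γ) • v' + w))
    (h1 : G + γ / 2 * ‖y + v'‖ ^ 2 ≤ inner ℝ (y + v') w) (h2 : G - g ≤ inner ℝ v' w)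
    (ha : 0 ≤ a) :
    ‖a • (y + v') + (τ' - 2 * a) • v'‖ ^ 2 + a ^ 2 * ‖y + v'‖ ^ 2 + 2 * τ ^ 2 * (1 - γ) * G
      + a * τ * γ * ‖y + v'‖ ^ 2
      + ((τ * (1 - γ) - a) ^ 2 - (τ' - 2 * a) ^ 2 + a ^ 2) * ‖v'‖ ^ 2 + τ ^ 2 * ‖w‖ ^ 2
      + 2 * a * (τ * (1 - γ) - τ') * inner ℝ (y + v') v' ≤ inertialEnergy a τ γ g y v := by
  set e := y + v' with he
  have hy : y = e - v' := by rw [he]; abel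
  set P := τ * (1 - γ) - a with hPdef
  set Q := τ' - 2 * a
  have hz : a • y + (τ - 2 * a) • v = a • e + P • v' + τ • w := by
    rw [hv, hy, hPdef]; module
  have hzn : ‖a • y + (τ - 2 * a) • v‖ ^ 2 = a ^ 2 * ‖e‖ ^ 2 + P ^ 2 * ‖v'‖ ^ 2 + τ ^ 2 * ‖w‖ ^ 2
      + 2 * a * P * inner ℝ e v' + 2 * a * τ * inner ℝ e w + 2 * P * τ * inner ℝ v' w := by
    rw [hz, norm_add_sq_real, norm_add_sq_real]
    simp only [inner_add_left, real_inner_smul_left, real_inner_smul_right, norm_smul, mul_pow,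
      Real.norm_eq_abs, sq_abs]
    ring
  have hQn : ‖a • e + Q • v'‖ ^ 2
      = a ^ 2 * ‖e‖ ^ 2 + 2 * a * Q * inner ℝ e v' + Q ^ 2 * ‖v'‖ ^ 2 := by
    rw [norm_add_sq_real]
    simp only [real_inner_smul_left, real_inner_smul_right, norm_smul, mul_pow,
      Real.norm_eq_abs, sq_abs]
    ring
  have hyn : ‖y‖ ^ 2 = ‖e‖ ^ 2 - 2 * inner ℝ e v' + ‖v'‖ ^ 2 := by
    rw [hy, norm_sub_sq_real]
  rw [inertialEnergy, hzn, hQn, hyn]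
  have m1 := mul_le_mul_of_nonneg_left h1 (show 0 ≤ 2 * a * τ by positivity)
  have m2 := mul_le_mul_of_nonneg_left h2 (show 0 ≤ 2 * P * τ by positivity)
  have hPQ : P - Q = τ * (1 - γ) - τ' + a := by simp only [P, Q]; ring
  have e1 : 2 * τ ^ 2 * (1 - γ) * G = 2 * a * τ * G + 2 * P * τ * G := by
    simp only [P]; ring
  have e2 : 2 * a * (τ * (1 - γ) - τ') * inner ℝ e v'
      = 2 * a * (P - Q - a) * inner ℝ e v' := by rw [hPQ]; ring
  rw [e1, e2]
  nlinarith

/-- The growth of the weight of the function gap from one step to the next is slower than the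
dissipation of the gap. -/
lemma gap_weight_succ_le {a c τ τ' γ γ' ε g' G B : ℝ} (ha : 0 < a) (hτ : 0 < τ) (hττ' : τ ≤ τ')
    (hτ' : τ' ≤ τ + τ * ε) (hε0 : 0 < ε) (hε1 : ε ≤ 1) (hγ0 : 0 < γ)
    (hτγ : τ * γ ≤ c * (τ * ε)) (hγ4 : γ ≤ 1 / 4) (hγ' : 0 ≤ γ')
    (hs1 : (6 + 2 * c) * (τ * ε) ≤ a) (hs2 : 8 * a ≤ τ)
    (hg' : 0 ≤ g') (hB : 0 ≤ B) (hgap : g' ≤ G + B) :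
    2 * (τ' * (1 - γ') - a) * τ' * g'
      ≤ 2 * τ ^ 2 * (1 - γ) * G - a * τ * G + 2 * τ ^ 2 * B := by
  have hτ'0 : 0 < τ' := hτ.trans_le hττ'
  have m1 : 2 * (τ' * (1 - γ') - a) * τ' ≤ 2 * τ' ^ 2 - 2 * a * τ' := by
    have : 0 ≤ γ' * τ' ^ 2 := by positivity
    nlinarith
  have m2 : τ' ^ 2 ≤ τ ^ 2 + 3 * (τ * (τ * ε)) := by
    calc τ' ^ 2 ≤ (τ + τ * ε) ^ 2 := by gcongr
      _ = τ ^ 2 + 2 * (τ * (τ * ε)) + τ ^ 2 * ε * ε := by ring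
      _ ≤ τ ^ 2 + 2 * (τ * (τ * ε)) + τ ^ 2 * ε * 1 := by gcongr
      _ = _ := by ring
  have m3 : τ * ((6 + 2 * c) * (τ * ε)) ≤ τ * a := by gcongr
  have m4 : τ * (τ * γ) ≤ τ * (c * (τ * ε)) := by gcongr
  have m5 : a * τ ≤ a * τ' := by gcongr
  have m6 : τ ^ 2 * γ ≤ τ ^ 2 * (1 / 4) := by gcongr
  have m7 : a * τ ≤ τ * τ := by gcongr; linarith
  have m8 : 2 * (τ' * (1 - γ') - a) * τ' ≤ 2 * τ ^ 2 * (1 - γ) - a * τ := by linarith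
  have m9 : 0 ≤ 2 * τ ^ 2 * (1 - γ) - a * τ := by linarith [sq_nonneg τ]
  have m10 : 0 ≤ τ ^ 2 * γ := by positivity
  have m11 : 0 ≤ a * τ := by positivity
  calc _ ≤ (2 * τ ^ 2 * (1 - γ) - a * τ) * g' := by gcongr
    _ ≤ (2 * τ ^ 2 * (1 - γ) - a * τ) * (G + B) := by gcongr
    _ = (2 * τ ^ 2 * (1 - γ) - a * τ) * G + (2 * τ ^ 2 * (1 - γ) - a * τ) * B := by ring
    _ ≤ (2 * τ ^ 2 * (1 - γ) - a * τ) * G + 2 * τ ^ 2 * B := by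
        gcongr
        linarith
    _ = _ := by ring

/-- The cross term left over by the slowly varying coefficients is absorbed by the dissipation. -/
lemma abs_cross_term_le {a c τ τ' γ ε : ℝ} {e v' : H} (ha : 0 < a) (hc : 0 ≤ c) (hτ : 0 < τ)
    (hττ' : τ ≤ τ') (hτ' : τ' ≤ τ + τ * ε) (hε0 : 0 < ε) (hγ0 : 0 < γ)
    (hτγ : τ * γ ≤ c * (τ * ε)) (hs3 : 64 * (1 + c) ^ 2 * ε ^ 2 ≤ γ) :
    |2 * a * (τ * (1 - γ) - τ') * inner ℝ e v'|
      ≤ a * τ * γ / 8 * ‖e‖ ^ 2 + a * τ / 8 * ‖v'‖ ^ 2 := by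
  set E := ‖e‖
  set N := ‖v'‖
  have hE : 0 ≤ E := norm_nonneg _
  have hN : 0 ≤ N := norm_nonneg _
  have hin : |inner ℝ e v'| ≤ E * N := abs_real_inner_le_norm e v'
  have hcoef : |τ * (1 - γ) - τ'| ≤ (1 + c) * (τ * ε) := by
    rw [abs_of_nonpos (by nlinarith [mul_pos hτ hγ0])]
    linarith
  set r := √γ with hr
  have hrγ : r ^ 2 = γ := Real.sq_sqrt hγ0.le
  have hr8 : 8 * (1 + c) * ε ≤ r := by
    refine Real.le_sqrt_of_sq_le (le_trans (le_of_eq ?_) hs3)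
    ring
  calc |2 * a * (τ * (1 - γ) - τ') * inner ℝ e v'|
        = 2 * a * |τ * (1 - γ) - τ'| * |inner ℝ e v'| := by
          rw [abs_mul, abs_mul, abs_of_pos (by positivity : 0 < 2 * a)]
      _ ≤ 2 * a * ((1 + c) * (τ * ε)) * (E * N) := by gcongr
      _ = a * τ / 4 * (8 * (1 + c) * ε) * (E * N) := by ring
      _ ≤ a * τ / 4 * r * (E * N) := by gcongr
      _ ≤ a * τ / 4 * r * (E * N) + a * τ / 8 * (r * E - N) ^ 2 :=
          le_add_of_nonneg_right (by positivity)
      _ = _ := by rw [← hrγ]; ring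

lemma kinetic_dissipation_ge {a c τ τ' γ ε : ℝ} (hτ : 0 < τ)
    (hττ' : τ ≤ τ') (hτ' : τ' ≤ τ + τ * ε) (hτε : 0 < τ * ε) (hcτε : 0 ≤ c * (τ * ε))
    (hτγ : τ * γ ≤ c * (τ * ε)) (hs1 : (6 + 2 * c) * (τ * ε) ≤ a) (hs2 : 8 * a ≤ τ) :
    a * τ / 2 ≤ (τ * (1 - γ) - a) ^ 2 - (τ' - 2 * a) ^ 2 + a ^ 2 := by
  set Q := τ' - 2 * a with hQ
  have n1 : a / 2 ≤ τ * (1 - γ) - a - Q := by rw [hQ]; linarith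
  have n2 : τ ≤ τ * (1 - γ) - a + Q := by rw [hQ]; nlinarith
  have n3 : a / 2 * τ ≤ (τ * (1 - γ) - a - Q) * (τ * (1 - γ) - a + Q) := by
    apply mul_le_mul n1 n2 hτ.le; linarith
  nlinarith [sq_nonneg a]

/-- One step of the scheme decreases the energy, up to a source made of the variation `B` of the
regularized optimal value and of the drift `δ` of the regularized minimizers. The smallness
conditions on the parameters `τ = k ^ q`, `ε = 1 / k` and `γ = c / k ^ p` hold for large `k`. -/
theorem inertialEnergy_descent {a c τ τ' γ γ' ε g g' G B : ℝ} {y v v' w δ : H}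
    (ha : 0 < a) (hc : 0 ≤ c) (hτ : 0 < τ) (hττ' : τ ≤ τ') (hτ' : τ' ≤ τ + τ * ε) (hε0 : 0 < ε)
    (hε1 : ε ≤ 1) (hγ0 : 0 < γ) (hγε : γ ≤ c * ε) (hγ4 : γ ≤ 1 / 4) (hγ' : 0 ≤ γ')
    (hs1 : (6 + 2 * c) * (τ * ε) ≤ a) (hs2 : 8 * a ≤ τ) (hs3 : 64 * (1 + c) ^ 2 * ε ^ 2 ≤ γ)
    (hg' : 0 ≤ g') (hB : 0 ≤ B) (hgap : g' ≤ G + B)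
    (hv : (τ - 2 * a) • v = τ • ((1 - γ) • v' + w))
    (h1 : G + γ / 2 * ‖y + v'‖ ^ 2 ≤ inner ℝ (y + v') w) (h2 : G - g ≤ inner ℝ v' w) :
    inertialEnergy a τ' γ' g' (y + v' - δ) v' + (a * τ * g' + a / 4 * τ * γ * ‖y + v' - δ‖ ^ 2
      + a / 4 * τ * ‖v'‖ ^ 2 + τ ^ 2 * ‖w‖ ^ 2) ≤ inertialEnergy a τ γ g y v
      + (3 * τ ^ 2 * B + 32 * a ^ 3 * ‖δ‖ ^ 2 / (τ * γ) + 35 * a * τ * ‖δ‖ ^ 2) := by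
  have hτγ : τ * γ ≤ c * (τ * ε) := by
    calc τ * γ ≤ τ * (c * ε) := by gcongr
      _ = _ := by ring
  have hτγ4 : τ * γ ≤ τ * (1 / 4) := by gcongr
  have hτε1 : τ * ε ≤ τ * 1 := by gcongr
  have hτε : 0 < τ * ε := by positivity
  have hcτε : 0 ≤ c * (τ * ε) := by positivity
  have hτ'0 : 0 < τ' := hτ.trans_le hττ'
  have hP : 0 ≤ τ * (1 - γ) - a := by linarith
  have hex := inertialEnergy_descent_exact (τ' := τ') hτ.le hP hv h1 h2 ha.le
  set e := y + v' with he
  set E := ‖e‖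
  set N := ‖v'‖
  set d := ‖δ‖
  have hE : 0 ≤ E := norm_nonneg _
  have hN : 0 ≤ N := norm_nonneg _
  have hd : 0 ≤ d := norm_nonneg _
  set Q := τ' - 2 * a with hQ
  have hQ0 : 0 ≤ Q := by linarith
  have hQ2 : Q ≤ 2 * τ := by linarith
  -- the displacement of the regularized minimizer inside the two quadratic terms
  have S1 : ‖a • (e - δ) + Q • v'‖ ^ 2
      ≤ ‖a • e + Q • v'‖ ^ 2 + 2 * (a * d) * (a * E + Q * N) + a ^ 2 * d ^ 2 := by
    have t1 : ‖a • e + Q • v'‖ ≤ a * E + Q * N := by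
      refine (norm_add_le _ _).trans_eq ?_
      rw [norm_smul, norm_smul, Real.norm_of_nonneg ha.le, Real.norm_of_nonneg hQ0]
    have t2 : ‖a • (e - δ) + Q • v'‖ ≤ ‖a • e + Q • v'‖ + a * d := by
      rw [show a • (e - δ) + Q • v' = (a • e + Q • v') - a • δ by module]
      refine (norm_sub_le _ _).trans_eq ?_
      rw [norm_smul, Real.norm_of_nonneg ha.le]
    calc _ ≤ (‖a • e + Q • v'‖ + a * d) ^ 2 := by gcongr
      _ = ‖a • e + Q • v'‖ ^ 2 + 2 * (a * d) * ‖a • e + Q • v'‖ + a ^ 2 * d ^ 2 := by ring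
      _ ≤ _ := by gcongr
  have S2 : ‖e - δ‖ ^ 2 ≤ E ^ 2 + 2 * E * d + d ^ 2 := by
    calc _ ≤ (E + d) ^ 2 := by gcongr; exact norm_sub_le _ _
      _ = _ := by ring
  have S3 := gap_weight_succ_le ha hτ hττ' hτ' hε0 hε1 hγ0 hτγ hγ4 hγ' hs1 hs2 hg' hB hgap
  have S4 := neg_le_of_abs_le
    (abs_cross_term_le (e := e) (v' := v') ha hc hτ hττ' hτ' hε0 hγ0 hτγ hs3)
  have S5 : a * τ / 2 * N ^ 2 ≤ ((τ * (1 - γ) - a) ^ 2 - Q ^ 2 + a ^ 2) * N ^ 2 := by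
    have := kinetic_dissipation_ge hτ hττ' hτ' hτε hcτε hτγ hs1 hs2
    gcongr
  have S6 : 4 * a ^ 2 * d * E ≤ a * τ * γ / 8 * E ^ 2 + 32 * a ^ 3 * d ^ 2 / (τ * γ) := by
    have hpos : 0 < τ * γ := by positivity
    have : a * τ * γ / 8 * E ^ 2 + 32 * a ^ 3 * d ^ 2 / (τ * γ) - 4 * a ^ 2 * d * E
        = a / (8 * (τ * γ)) * (τ * γ * E - 16 * a * d) ^ 2 := by
      field_simp
      ring
    have h0 : 0 ≤ a / (8 * (τ * γ)) * (τ * γ * E - 16 * a * d) ^ 2 := by positivity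
    linarith
  have S7 : 2 * a * Q * d * N ≤ a * τ / 8 * N ^ 2 + 32 * a * τ * d ^ 2 := by
    calc 2 * a * Q * d * N ≤ 2 * a * (2 * τ) * d * N := by gcongr
      _ ≤ 2 * a * (2 * τ) * d * N + a * τ / 8 * (N - 16 * d) ^ 2 :=
          le_add_of_nonneg_right (by positivity)
      _ = _ := by ring
  have S8 : 2 * a ^ 2 * d ^ 2 ≤ 2 * a * τ * d ^ 2 := by
    have : a ≤ τ := by linarith
    calc 2 * a ^ 2 * d ^ 2 = 2 * a * a * d ^ 2 := by ring
      _ ≤ _ := by gcongr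
  have S9 : a / 4 * τ * γ * ‖e - δ‖ ^ 2 ≤ a * τ * γ / 2 * E ^ 2 + a * τ * d ^ 2 := by
    have k1 : ‖e - δ‖ ^ 2 ≤ 2 * E ^ 2 + 2 * d ^ 2 := by linarith [sq_nonneg (E - d)]
    calc _ ≤ a / 4 * τ * γ * (2 * E ^ 2 + 2 * d ^ 2) := by gcongr
      _ = a * τ * γ / 2 * E ^ 2 + a * τ * d ^ 2 * (γ / 2) := by ring
      _ ≤ a * τ * γ / 2 * E ^ 2 + a * τ * d ^ 2 * 1 := by gcongr; linarith
      _ = _ := by ring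
  have S10 : a * τ * g' ≤ a * τ * G + τ ^ 2 * B := by
    calc a * τ * g' ≤ a * τ * (G + B) := by gcongr
      _ = a * τ * G + a * τ * B := by ring
      _ ≤ a * τ * G + τ * τ * B := by gcongr; linarith
      _ = _ := by ring
  have S11 : 0 ≤ a * τ * γ * E ^ 2 := by positivity
  have S2' := mul_le_mul_of_nonneg_left S2 (sq_nonneg a)
  rw [inertialEnergy]
  linarith

/-- The energy is controlled by the dissipation, with the loss of a factor `S` that dominates
`τ` and `1 / (τ γ)`. -/
lemma inertialEnergy_le {a τ τ' γ γ' g' S : ℝ} {y v : H} (ha : 0 < a) (hτ : 0 < τ)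
    (hττ' : τ ≤ τ') (hτ' : τ' ≤ 2 * τ) (hs2 : 8 * a ≤ τ) (hγ0 : 0 < γ) (hγ' : 0 ≤ γ')
    (hg' : 0 ≤ g') (hS1 : τ ≤ S) (hS2 : 1 ≤ S * (τ * γ)) :
    inertialEnergy a τ' γ' g' y v
      ≤ (8 * (1 + a ^ 2)) * S * (τ * g' + τ * γ * ‖y‖ ^ 2 + τ * ‖v‖ ^ 2) := by
  have hτ'0 : 0 < τ' := hτ.trans_le hττ'
  have hQ0 : 0 ≤ τ' - 2 * a := by linarith
  have hQ2 : τ' - 2 * a ≤ 2 * τ := by linarith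
  have h1 : ‖a • y + (τ' - 2 * a) • v‖ ^ 2 ≤ 2 * a ^ 2 * ‖y‖ ^ 2 + 8 * τ ^ 2 * ‖v‖ ^ 2 := by
    have t1 : ‖a • y + (τ' - 2 * a) • v‖ ≤ a * ‖y‖ + 2 * τ * ‖v‖ := by
      refine (norm_add_le _ _).trans ?_
      rw [norm_smul, norm_smul, Real.norm_of_nonneg ha.le, Real.norm_of_nonneg hQ0]
      gcongr
    calc _ ≤ (a * ‖y‖ + 2 * τ * ‖v‖) ^ 2 := by gcongr
      _ ≤ _ := by nlinarith [sq_nonneg (a * ‖y‖ - 2 * τ * ‖v‖)]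
  have h2 : 2 * (τ' * (1 - γ') - a) * τ' * g' ≤ 8 * τ ^ 2 * g' := by
    have : 2 * (τ' * (1 - γ') - a) * τ' ≤ 8 * τ ^ 2 := by
      have h0 : 0 ≤ γ' * τ' ^ 2 := by positivity
      have h3 : 0 ≤ a * τ' := by nlinarith
      have h4 : τ' ^ 2 ≤ (2 * τ) ^ 2 := by gcongr
      nlinarith
    gcongr
  have h3 : τ ^ 2 ≤ S * τ := by nlinarith
  have h4 : τ ^ 2 * g' ≤ S * τ * g' := by gcongr
  have h5 : τ ^ 2 * ‖v‖ ^ 2 ≤ S * τ * ‖v‖ ^ 2 := by gcongr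
  have h6 : 1 * ‖y‖ ^ 2 ≤ S * (τ * γ) * ‖y‖ ^ 2 := by gcongr
  have hSpos : 0 < S := hτ.trans_le hS1
  have p1 : 0 ≤ S * τ * g' := by positivity
  have p2 : 0 ≤ S * τ * ‖v‖ ^ 2 := by positivity
  have p3 : 0 ≤ S * (τ * γ) * ‖y‖ ^ 2 := by positivity
  have q1 := mul_le_mul_of_nonneg_left h6 (sq_nonneg a)
  have q2 := mul_nonneg (sq_nonneg a) p1
  have q3 := mul_nonneg (sq_nonneg a) p2
  have q4 := mul_nonneg (sq_nonneg a) p3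
  rw [inertialEnergy]
  nlinarith

/-- The energy dominates each of the quantities whose rate is sought. -/
lemma le_inertialEnergy {a τ γ g : ℝ} {y v : H} (ha : 0 < a) (hs2 : 8 * a ≤ τ)
    (hγ4 : γ ≤ 1 / 4) (hg : 0 ≤ g) :
    a ^ 2 * ‖y‖ ^ 2 ≤ inertialEnergy a τ γ g y v ∧
      τ ^ 2 * g ≤ inertialEnergy a τ γ g y v ∧
      τ ^ 2 * ‖v‖ ^ 2 ≤ 8 * inertialEnergy a τ γ g y v := by
  have hτ : 0 < τ := by linarith
  have hM : τ ^ 2 ≤ 2 * (τ * (1 - γ) - a) * τ := by nlinarith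
  have h1 : τ ^ 2 * g ≤ 2 * (τ * (1 - γ) - a) * τ * g := by gcongr
  have h0 : 0 ≤ τ ^ 2 * g := by positivity
  have h2 : 0 ≤ a ^ 2 * ‖y‖ ^ 2 := by positivity
  have h3 := sq_nonneg ‖a • y + (τ - 2 * a) • v‖
  have h4 : (τ - 2 * a) ^ 2 * ‖v‖ ^ 2
      ≤ 2 * ‖a • y + (τ - 2 * a) • v‖ ^ 2 + 2 * (a ^ 2 * ‖y‖ ^ 2) := by
    have t0 : ‖(τ - 2 * a) • v‖ ≤ ‖a • y + (τ - 2 * a) • v‖ + ‖a • y‖ := by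
      have := norm_sub_le (a • y + (τ - 2 * a) • v) (a • y)
      rwa [add_sub_cancel_left] at this
    have t1 : ‖(τ - 2 * a) • v‖ ^ 2 ≤ (‖a • y + (τ - 2 * a) • v‖ + ‖a • y‖) ^ 2 := by gcongr
    have t2 : ‖(τ - 2 * a) • v‖ ^ 2 = (τ - 2 * a) ^ 2 * ‖v‖ ^ 2 := by
      rw [norm_smul, mul_pow, Real.norm_eq_abs, sq_abs]
    have t3 : ‖a • y‖ ^ 2 = a ^ 2 * ‖y‖ ^ 2 := by
      rw [norm_smul, mul_pow, Real.norm_eq_abs, sq_abs]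
    nlinarith [sq_nonneg (‖a • y + (τ - 2 * a) • v‖ - ‖a • y‖)]
  have h5 : τ ^ 2 * ‖v‖ ^ 2 ≤ 2 * ((τ - 2 * a) ^ 2 * ‖v‖ ^ 2) := by
    have : τ ^ 2 ≤ 2 * (τ - 2 * a) ^ 2 := by nlinarith
    calc _ ≤ 2 * (τ - 2 * a) ^ 2 * ‖v‖ ^ 2 := by gcongr
      _ = _ := by ring
  rw [inertialEnergy]
  refine ⟨?_, ?_, ?_⟩ <;> linarith

end

/-! ### The energy estimate along the iterates -/

section

variable {H : Type*} [NormedAddCommGroup H] [InnerProductSpace ℝ H]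

/-- The data of the inertial proximal algorithm with unit stepsize: the parameters, the minimizers
of the regularized objectives, the iterates `x` and the subgradients `u` selected by the proximal
steps. -/
structure InertialTikhonovScheme (f : H → EReal) (α q c p : ℝ) (xstar : H) (xbar x u : ℕ → H) :
    Prop where
  convexLsc : ProperConvexLsc f
  α_pos : 0 < α
  c_pos : 0 < c
  q_pos : 0 < q
  q_lt_one : q < 1
  one_lt_p : 1 < p
  p_lt : p < q + 1
  xstar_min : IsMinNormMinimizer f xstar
  xbar_min : ∀ k : ℕ, 1 ≤ k → xbar k ∈ argminSet (tikhonovReg f c p k)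
  iterates : IsPIATR f α q c p (fun _ => 1) x
  subgradients : ∀ k : ℕ, 2 ≤ k →
    x k = inertialCoeff α q (k - 1) • (x (k - 1) - x (k - 2)) - u k
      + (1 - tikhonovCoeff c p (k - 1)) • x (k - 1)

/-- The real number `f_k (x k) - f_k (xbar k)`, meaningful for `k ≥ 2`, where both values are finite. -/
noncomputable def regGap (f : H → EReal) (c p : ℝ) (xbar x : ℕ → H) (k : ℕ) : ℝ :=
  (tikhonovReg f c p k (x k)).toReal - (tikhonovReg f c p k (xbar k)).toReal

/-- The Lyapunov function `inertialEnergy` along the iterates. -/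
noncomputable def schemeEnergy (f : H → EReal) (α q c p : ℝ) (xbar x : ℕ → H) (k : ℕ) : ℝ :=
  inertialEnergy (α / 2) ((k : ℝ) ^ q) (tikhonovCoeff c p k) (regGap f c p xbar x k)
    (x k - xbar k) (x k - x (k - 1))

/-- The subgradient inequality for `z ↦ F z + γ / 2 * ‖z‖ ^ 2` at `x'`, in terms of the subgradient
`u` of `F`. -/
lemma regularized_subgradient_inequality {Fx Fz γ : ℝ} {x' z u : H}
    (h : Fx + inner ℝ u (z - x') ≤ Fz) :
    (Fx + γ / 2 * ‖x'‖ ^ 2) - (Fz + γ / 2 * ‖z‖ ^ 2) + γ / 2 * ‖x' - z‖ ^ 2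
      ≤ inner ℝ (x' - z) (u + γ • x') := by
  have e1 : ‖z‖ ^ 2 = ‖x'‖ ^ 2 - 2 * inner ℝ (x' - z) x' + ‖x' - z‖ ^ 2 := by
    have := norm_sub_sq_real x' (x' - z)
    rw [sub_sub_cancel, real_inner_comm] at this
    exact this
  have e2 : inner ℝ u (z - x') = -inner ℝ (x' - z) u := by
    rw [← inner_neg_left, neg_sub, real_inner_comm]
  rw [inner_add_right, real_inner_smul_right, e1]
  rw [e2] at h
  linarith

namespace InertialTikhonovScheme

variable {f : H → EReal} {α q c p : ℝ} {xstar : H} {xbar x u : ℕ → H}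

theorem mem_subdiff (h : InertialTikhonovScheme f α q c p xstar xbar x u) {k : ℕ} (hk : 2 ≤ k) :
    f (x k) ≠ ⊤ ∧ u k ∈ subdiff f (x k) := by
  obtain ⟨j, rfl⟩ : ∃ j, k = j + 2 := ⟨k - 2, by omega⟩
  have h1 := h.iterates (j + 1) (by omega)
  have h2 := h.subgradients (j + 2) (by omega)
  simp only [show j + 2 - 1 = j + 1 by omega, show j + 2 - 2 = j by omega,
    show j + 1 - 1 = j by omega, show j + 1 + 1 = j + 2 by omega] at h1 h2
  rw [proxSet] at h1
  refine ⟨ne_top_of_mem_argminSet_add_coe h.convexLsc h1, ?_⟩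
  rw [mul_one] at h1
  have h3 := smul_sub_mem_subdiff_of_mem_argminSet h.convexLsc h1
  have e : u (j + 2) = (1 : ℝ) • (x (j + 1) + inertialCoeff α q (j + 1) • (x (j + 1) - x j)
      - tikhonovCoeff c p (j + 1) • x (j + 1) - x (j + 2)) := by
    have : u (j + 2) = inertialCoeff α q (j + 1) • (x (j + 1) - x j)
        + (1 - tikhonovCoeff c p (j + 1)) • x (j + 1) - x (j + 2) := by
      rw [h2]; abel
    rw [this]; module
  rw [e]
  exact h3

lemma ne_top (h : InertialTikhonovScheme f α q c p xstar xbar x u) {k : ℕ} (hk : 2 ≤ k) :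
    f (x k) ≠ ⊤ := (h.mem_subdiff hk).1

lemma xbar_ne_top (h : InertialTikhonovScheme f α q c p xstar xbar x u) {k : ℕ} (hk : 1 ≤ k) :
    f (xbar k) ≠ ⊤ := ne_top_of_mem_argminSet_add_coe h.convexLsc (h.xbar_min k hk)

lemma xstar_ne_top (h : InertialTikhonovScheme f α q c p xstar xbar x u) : f xstar ≠ ⊤ :=
  ne_top_of_mem_argminSet h.convexLsc h.xstar_min.1

lemma regGap_eq (h : InertialTikhonovScheme f α q c p xstar xbar x u) {k : ℕ} (hk : 2 ≤ k) :
    regGap f c p xbar x k = ((f (x k)).toReal + tikhonovCoeff c p k / 2 * ‖x k‖ ^ 2)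
      - ((f (xbar k)).toReal + tikhonovCoeff c p k / 2 * ‖xbar k‖ ^ 2) := by
  rw [regGap, toReal_tikhonovReg h.convexLsc _ _ _ (h.ne_top hk),
    toReal_tikhonovReg h.convexLsc _ _ _ (h.xbar_ne_top (by omega))]

/-- Strong convexity of the regularized objective at its minimizer. -/
lemma quadratic_growth (h : InertialTikhonovScheme f α q c p xstar xbar x u) {k : ℕ} (hk : 1 ≤ k)
    {z : H} (hz : f z ≠ ⊤) :
    ((f (xbar k)).toReal + tikhonovCoeff c p k / 2 * ‖xbar k‖ ^ 2)
      + tikhonovCoeff c p k / 2 * ‖z - xbar k‖ ^ 2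
      ≤ (f z).toReal + tikhonovCoeff c p k / 2 * ‖z‖ ^ 2 := by
  have h1 := tikhonov_subgradient_inequality h.convexLsc (h.xbar_min k hk) hz
  have e : ‖z‖ ^ 2 = ‖xbar k‖ ^ 2 + 2 * inner ℝ (xbar k) (z - xbar k) + ‖z - xbar k‖ ^ 2 := by
    rw [← norm_add_sq_real, add_sub_cancel]
  rw [e]
  linarith

lemma dist_sq_le_regGap (h : InertialTikhonovScheme f α q c p xstar xbar x u) {k : ℕ}
    (hk : 2 ≤ k) : tikhonovCoeff c p k / 2 * ‖x k - xbar k‖ ^ 2 ≤ regGap f c p xbar x k := by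
  have := h.quadratic_growth (by omega : 1 ≤ k) (h.ne_top hk)
  rw [h.regGap_eq hk]
  linarith

lemma regGap_nonneg (h : InertialTikhonovScheme f α q c p xstar xbar x u) {k : ℕ} (hk : 2 ≤ k) :
    0 ≤ regGap f c p xbar x k := by
  have := tikhonovCoeff_pos (p := p) h.c_pos (by omega : 1 ≤ k)
  exact le_trans (by positivity) (h.dist_sq_le_regGap hk)

/-- The scheme in terms of velocities and of the subgradient `u (k + 1) + c_k x (k + 1)` of `f_k`
at `x (k + 1)`. -/
lemma velocity_recurrence (h : InertialTikhonovScheme f α q c p xstar xbar x u) {k : ℕ}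
    (hk : 1 ≤ k) :
    ((k : ℝ) ^ q - 2 * (α / 2)) • (x k - x (k - 1))
      = (k : ℝ) ^ q • ((1 - tikhonovCoeff c p k) • (x (k + 1) - x k)
        + (u (k + 1) + tikhonovCoeff c p k • x (k + 1))) := by
  have h2 := h.subgradients (k + 1) (by omega)
  simp only [show k + 1 - 1 = k by omega, show k + 1 - 2 = k - 1 by omega] at h2
  have hτ : (k : ℝ) ^ q ≠ 0 :=
    (Real.rpow_pos_of_pos (by exact_mod_cast hk) q).ne'
  have e : (1 - tikhonovCoeff c p k) • (x (k + 1) - x k)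
      + (u (k + 1) + tikhonovCoeff c p k • x (k + 1))
      = inertialCoeff α q k • (x k - x (k - 1)) := by
    have : (1 - tikhonovCoeff c p k) • (x (k + 1) - x k)
      + (u (k + 1) + tikhonovCoeff c p k • x (k + 1))
      = x (k + 1) + u (k + 1) - (1 - tikhonovCoeff c p k) • x k := by module
    rw [this]
    nth_rewrite 1 [h2]
    abel
  rw [e, smul_smul, inertialCoeff]
  congr 1
  field_simp

/-- The parameter regime in which a step decreases the energy is eventually reached. -/
lemma eventually_parameters (h : InertialTikhonovScheme f α q c p xstar xbar x u) :
    ∀ᶠ k : ℕ in atTop, 2 ≤ k ∧ (k : ℝ) ^ q ≤ ((k + 1 : ℕ) : ℝ) ^ q ∧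
      ((k + 1 : ℕ) : ℝ) ^ q ≤ (k : ℝ) ^ q + (k : ℝ) ^ q * (1 / k) ∧
      tikhonovCoeff c p k ≤ c * (1 / k) ∧ tikhonovCoeff c p k ≤ 1 / 4 ∧
      (6 + 2 * c) * ((k : ℝ) ^ q * (1 / k)) ≤ α / 2 ∧ 8 * (α / 2) ≤ (k : ℝ) ^ q ∧
      64 * (1 + c) ^ 2 * (1 / (k : ℝ)) ^ 2 ≤ tikhonovCoeff c p k := by
  have hq0 := h.q_pos
  have hq1 := h.q_lt_one
  have hp1 := h.one_lt_p
  have hpq := h.p_lt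
  have hc := h.c_pos
  have hα := h.α_pos
  filter_upwards [eventually_ge_atTop 2,
    eventually_mul_natCast_rpow_le (e := -p) (ε := 1 / 4) c (by linarith) (by norm_num),
    eventually_mul_natCast_rpow_le (e := q - 1) (ε := α / 2) (6 + 2 * c) (by linarith)
      (by linarith),
    eventually_mul_natCast_rpow_le (e := -q) (ε := 1) (8 * (α / 2)) (by linarith) (by norm_num),
    eventually_mul_natCast_rpow_le (e := p - 2) (ε := c) (64 * (1 + c) ^ 2) (by linarith) hc]
    with k hk h1 h2 h3 h4
  have hk1 : (1 : ℝ) ≤ k := by exact_mod_cast (by omega : 1 ≤ k)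
  have hk0 : (0 : ℝ) < k := by linarith
  refine ⟨hk, ?_, ?_, ?_, ?_, ?_, ?_, ?_⟩
  · push_cast
    gcongr
    simp
  · push_cast
    exact add_one_rpow_le hq0.le hq1.le hk1
  · rw [tikhonovCoeff_eq, one_div, ← Real.rpow_neg_one]
    gcongr
  · rwa [tikhonovCoeff_eq]
  · rwa [one_div, ← Real.rpow_neg_one, ← Real.rpow_add hk0, ← sub_eq_add_neg]
  · have hpos := Real.rpow_pos_of_pos hk0 q
    rw [Real.rpow_neg hk0.le, ← div_eq_mul_inv, div_le_one hpos] at h3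
    exact h3
  · have e : (1 / (k : ℝ)) ^ 2 = (k : ℝ) ^ (p - 2) * (k : ℝ) ^ (-p) := by
      rw [← Real.rpow_add hk0, one_div, inv_pow, show p - 2 + -p = -(2 : ℝ) by ring,
        Real.rpow_neg hk0.le, Real.rpow_two]
    rw [tikhonovCoeff_eq, e, ← mul_assoc]
    gcongr

/-- The basic energy estimate: decrease of the Lyapunov function by the dissipation, up to the
sources `k ^ (2 q - p - 1)` (variation of the regularized optimal values) and `k ^ (p - q - 2)`
(drift of the regularized minimizers). -/
theorem energy_estimate (h : InertialTikhonovScheme f α q c p xstar xbar x u) :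
    ∃ C : ℝ, 0 ≤ C ∧ ∀ᶠ k : ℕ in atTop,
      schemeEnergy f α q c p xbar x (k + 1)
        + (α / 2 * (k : ℝ) ^ q * regGap f c p xbar x (k + 1)
          + α / 2 / 4 * (k : ℝ) ^ q * tikhonovCoeff c p k * ‖x (k + 1) - xbar (k + 1)‖ ^ 2
          + α / 2 / 4 * (k : ℝ) ^ q * ‖x (k + 1) - x k‖ ^ 2
          + ((k : ℝ) ^ q) ^ 2 * ‖u (k + 1) + tikhonovCoeff c p k • x (k + 1)‖ ^ 2)
        ≤ schemeEnergy f α q c p xbar x k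
          + C * ((k : ℝ) ^ (2 * q - p - 1) + (k : ℝ) ^ (p - q - 2)) := by
  have hc := h.c_pos
  have hα := h.α_pos
  have hp1 := h.one_lt_p
  have hpq := h.p_lt
  set D := p * ‖xstar‖ with hD
  set A := 3 * (p * c * ‖xstar‖ ^ 2 / 2) + 35 * (α / 2) * D ^ 2 with hA
  set A' := 32 * (α / 2) ^ 3 * D ^ 2 / c with hA'
  have hA0 : 0 ≤ A := by positivity
  have hA'0 : 0 ≤ A' := by positivity
  refine ⟨A + A', by positivity, ?_⟩
  filter_upwards [h.eventually_parameters] with k hk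
  obtain ⟨hk2, hττ', hτ', hγε, hγ4, hs1, hs2, hs3⟩ := hk
  have hk1 : 1 ≤ k := by omega
  have hk1' : (1 : ℝ) ≤ k := by exact_mod_cast hk1
  have hk0 : (0 : ℝ) < k := by linarith
  have hγ := tikhonovCoeff_pos (p := p) hc hk1
  have hγ' := tikhonovCoeff_pos (p := p) hc (by omega : 1 ≤ k + 1)
  have hanti := tikhonovCoeff_anti hc (p := p) (by linarith) hk1 (Nat.le_succ k)
  have hdiff := tikhonovCoeff_sub_le hc hp1.le hk1
  have hcoef := tikhonovCoeff_eq c p k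
  have hτ : 0 < (k : ℝ) ^ q := Real.rpow_pos_of_pos hk0 q
  have hdrift := norm_tikhonov_step_le h.convexLsc hc hp1.le hk1 (h.xbar_min k hk1)
    (h.xbar_min (k + 1) (by omega)) h.xstar_min.1
  have hsub := h.mem_subdiff (by omega : 2 ≤ k + 1)
  have hmin := h.quadratic_growth hk1 (h.xbar_ne_top (by omega : 1 ≤ k + 1))
  have hnorm := norm_tikhonov_minimizer_le h.convexLsc hc (by omega : 1 ≤ k + 1)
    (h.xbar_min (k + 1) (by omega)) h.xstar_min.1
  have hg' := h.regGap_nonneg (by omega : 2 ≤ k + 1)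
  have hgk := h.regGap_eq hk2
  have hgk' := h.regGap_eq (by omega : 2 ≤ k + 1)
  have hI1 := regularized_subgradient_inequality (γ := tikhonovCoeff c p k)
    (toReal_add_inner_le_of_mem_subdiff h.convexLsc hsub.2 hsub.1 (h.xbar_ne_top hk1))
  have hI2 := regularized_subgradient_inequality (γ := tikhonovCoeff c p k)
    (toReal_add_inner_le_of_mem_subdiff h.convexLsc hsub.2 hsub.1 (h.ne_top hk2))
  have hvel := h.velocity_recurrence hk1
  set γ := tikhonovCoeff c p k with hγdef
  set γ' := tikhonovCoeff c p (k + 1) with hγ'def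
  set G := ((f (x (k + 1))).toReal + γ / 2 * ‖x (k + 1)‖ ^ 2)
    - ((f (xbar k)).toReal + γ / 2 * ‖xbar k‖ ^ 2) with hG
  have hgap : regGap f c p xbar x (k + 1) ≤ G + p / k * γ * ‖xstar‖ ^ 2 / 2 := by
    have h0 : 0 ≤ γ / 2 * ‖xbar (k + 1) - xbar k‖ ^ 2 := by positivity
    have h2 : (γ - γ') / 2 * ‖xbar (k + 1)‖ ^ 2 ≤ p / k * γ / 2 * ‖xstar‖ ^ 2 := by gcongr
    have h3 : 0 ≤ (γ - γ') / 2 * ‖x (k + 1)‖ ^ 2 := by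
      have : 0 ≤ γ - γ' := by linarith
      positivity
    rw [hgk', hG]
    linarith
  have hsum : x k - xbar k + (x (k + 1) - x k) = x (k + 1) - xbar k := by abel
  have hmain := inertialEnergy_descent (a := α / 2) (δ := xbar (k + 1) - xbar k)
    (y := x k - xbar k) (v' := x (k + 1) - x k) (g := regGap f c p xbar x k)
    (by positivity) hc.le hτ hττ' hτ' (by positivity)
    (by rw [div_le_one hk0]; exact hk1') hγ hγε hγ4 hγ'.le hs1 hs2 hs3 hg' (by positivity) hgap
    hvel (by rw [hsum]; exact hI1)
    (by
      have h0 : 0 ≤ γ / 2 * ‖x (k + 1) - x k‖ ^ 2 := by positivity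
      rw [hgk, hG]; linarith)
  have hdif : x k - xbar k + (x (k + 1) - x k) - (xbar (k + 1) - xbar k)
      = x (k + 1) - xbar (k + 1) := by abel
  rw [hdif] at hmain
  refine hmain.trans ?_
  rw [schemeEnergy]
  gcongr
  have hd2 : ‖xbar (k + 1) - xbar k‖ ^ 2 ≤ D ^ 2 * (k : ℝ) ^ (-2 : ℝ) := by
    calc _ ≤ (D * (1 / k)) ^ 2 := by gcongr
      _ = _ := by rw [Real.rpow_neg hk0.le, Real.rpow_two]; field_simp
  have T1 : 3 * ((k : ℝ) ^ q) ^ 2 * (p / k * γ * ‖xstar‖ ^ 2 / 2)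
      = 3 * (p * c * ‖xstar‖ ^ 2 / 2) * (k : ℝ) ^ (2 * q - p - 1) := by
    have e : (k : ℝ) ^ (2 * q - p - 1) = ((k : ℝ) ^ q) ^ 2 * (k : ℝ) ^ (-p) * (k : ℝ)⁻¹ := by
      rw [← Real.rpow_natCast, ← Real.rpow_mul hk0.le, ← Real.rpow_neg_one,
        ← Real.rpow_add hk0, ← Real.rpow_add hk0]
      congr 1; push_cast; ring
    rw [e, hcoef]; field_simp
  have T2 : 32 * (α / 2) ^ 3 * ‖xbar (k + 1) - xbar k‖ ^ 2 / ((k : ℝ) ^ q * γ)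
      ≤ A' * (k : ℝ) ^ (p - q - 2) := by
    have e : (k : ℝ) ^ (p - q - 2) * ((k : ℝ) ^ q * (k : ℝ) ^ (-p)) = (k : ℝ) ^ (-2 : ℝ) := by
      rw [← Real.rpow_add hk0, ← Real.rpow_add hk0]
      congr 1; ring
    rw [div_le_iff₀ (by positivity), hcoef]
    calc _ ≤ 32 * (α / 2) ^ 3 * (D ^ 2 * (k : ℝ) ^ (-2 : ℝ)) := by gcongr
      _ = _ := by rw [← e, hA']; field_simp
  have T3 : 35 * (α / 2) * (k : ℝ) ^ q * ‖xbar (k + 1) - xbar k‖ ^ 2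
      ≤ 35 * (α / 2) * D ^ 2 * (k : ℝ) ^ (2 * q - p - 1) := by
    calc _ ≤ 35 * (α / 2) * (k : ℝ) ^ q * (D ^ 2 * (k : ℝ) ^ (-2 : ℝ)) := by gcongr
      _ = 35 * (α / 2) * D ^ 2 * ((k : ℝ) ^ (q + -2)) := by rw [Real.rpow_add hk0]; ring
      _ ≤ _ := by
          gcongr
          linarith
  have P1 : 0 ≤ A' * (k : ℝ) ^ (2 * q - p - 1) := by positivity
  have P2 : 0 ≤ A * (k : ℝ) ^ (p - q - 2) := by positivity
  rw [T1]
  calc _ ≤ 3 * (p * c * ‖xstar‖ ^ 2 / 2) * (k : ℝ) ^ (2 * q - p - 1)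
        + A' * (k : ℝ) ^ (p - q - 2)
        + 35 * (α / 2) * D ^ 2 * (k : ℝ) ^ (2 * q - p - 1) := by gcongr
    _ = A * (k : ℝ) ^ (2 * q - p - 1) + A' * (k : ℝ) ^ (p - q - 2) := by rw [hA]; ring
    _ ≤ _ := by linarith

end InertialTikhonovScheme

end

/-! ### Rates and sum estimates -/

section

lemma isBigO_of_nonneg_le {f g : ℕ → ℝ} (C : ℝ) (hf : ∀ᶠ k in atTop, 0 ≤ f k)
    (hle : ∀ᶠ k in atTop, f k ≤ C * g k) (hg : ∀ k, 0 ≤ g k) : f =O[atTop] g := by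
  refine IsBigO.of_bound C ?_
  filter_upwards [hf, hle] with k h1 h2
  rwa [Real.norm_of_nonneg h1, Real.norm_of_nonneg (hg k)]

lemma isBigO_natCast_rpow {a b : ℝ} (hab : a ≤ b) :
    (fun k : ℕ => (k : ℝ) ^ a) =O[atTop] fun k : ℕ => (k : ℝ) ^ b := by
  refine isBigO_of_nonneg_le 1 (Eventually.of_forall fun k => by positivity) ?_
    (fun k => by positivity)
  filter_upwards [eventually_ge_atTop 1] with k hk
  rw [one_mul]
  exact Real.rpow_le_rpow_of_exponent_le (by exact_mod_cast hk) hab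

lemma isBigO_rpow_of_succ {Z : ℕ → ℝ} {e : ℝ}
    (h : (fun k => Z (k + 1)) =O[atTop] fun k : ℕ => (k : ℝ) ^ e) :
    Z =O[atTop] fun k : ℕ => (k : ℝ) ^ e := by
  have h2 : (fun k : ℕ => (k : ℝ) ^ e) =O[atTop] fun k : ℕ => ((k + 1 : ℕ) : ℝ) ^ e := by
    refine isBigO_of_nonneg_le 2 (Eventually.of_forall fun k => by positivity) ?_
      (fun k => by positivity)
    set m : ℝ := max 1 (-e)
    have hme : -m ≤ e := by have := le_max_right 1 (-e); linarith
    filter_upwards [eventually_ge_atTop 1,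
      eventually_mul_natCast_rpow_le (e := -1) (ε := 1 / 2) m (by norm_num) (by norm_num)]
      with k hk hsm
    have hk0 : (0 : ℝ) < k := by exact_mod_cast hk
    have hB := rpow_mul_one_sub_le_add_one_rpow (le_max_left 1 (-e)) hme hk0
    rw [Real.rpow_neg_one, ← div_eq_mul_inv] at hsm
    have hX : 0 < (k : ℝ) ^ e := Real.rpow_pos_of_pos hk0 e
    push_cast
    nlinarith
  have h3 := h.trans h2
  rw [← map_add_atTop_eq_nat 1, isBigO_map]
  exact h3

lemma isBigO_rpow_of_weighted_le {Z V : ℕ → ℝ} {q σ : ℝ} (C : ℝ)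
    (hZ : ∀ᶠ k in atTop, 0 ≤ Z k) (hV : V =O[atTop] fun k : ℕ => (k : ℝ) ^ σ)
    (h : ∀ᶠ k : ℕ in atTop, ((k : ℝ) ^ q) ^ 2 * Z k ≤ C * V k) :
    Z =O[atTop] fun k : ℕ => (k : ℝ) ^ (σ - 2 * q) := by
  obtain ⟨A, hA⟩ := hV.bound
  refine isBigO_of_nonneg_le (|C| * A) hZ ?_ (fun k => by positivity)
  filter_upwards [h, hA, eventually_ge_atTop 1] with k h1 h2 hk
  have hk0 : (0 : ℝ) < k := by exact_mod_cast hk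
  have e : (k : ℝ) ^ σ = ((k : ℝ) ^ q) ^ 2 * (k : ℝ) ^ (σ - 2 * q) := by
    rw [← Real.rpow_natCast, ← Real.rpow_mul hk0.le, ← Real.rpow_add hk0]
    congr 1; push_cast; ring
  rw [Real.norm_of_nonneg (by positivity : 0 ≤ (k : ℝ) ^ σ)] at h2
  have hpos : 0 < ((k : ℝ) ^ q) ^ 2 := by positivity
  refine le_of_mul_le_mul_left ?_ hpos
  calc _ ≤ C * V k := h1
    _ ≤ |C| * ‖V k‖ := by rw [Real.norm_eq_abs, ← abs_mul]; exact le_abs_self _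
    _ ≤ |C| * (A * (k : ℝ) ^ σ) := by gcongr
    _ = _ := by rw [e]; ring

variable {H : Type*} [NormedAddCommGroup H] [InnerProductSpace ℝ H]

namespace InertialTikhonovScheme

variable {f : H → EReal} {α q c p : ℝ} {xstar : H} {xbar x u : ℕ → H}

lemma eventually_le_energy (h : InertialTikhonovScheme f α q c p xstar xbar x u) :
    ∀ᶠ k : ℕ in atTop, 0 ≤ regGap f c p xbar x k ∧ 0 ≤ schemeEnergy f α q c p xbar x k ∧
      (α / 2) ^ 2 * ‖x k - xbar k‖ ^ 2 ≤ schemeEnergy f α q c p xbar x k ∧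
      ((k : ℝ) ^ q) ^ 2 * regGap f c p xbar x k ≤ 1 * schemeEnergy f α q c p xbar x k ∧
      ((k : ℝ) ^ q) ^ 2 * ‖x k - x (k - 1)‖ ^ 2 ≤ 8 * schemeEnergy f α q c p xbar x k := by
  have hα := h.α_pos
  filter_upwards [h.eventually_parameters] with k hk
  have hg := h.regGap_nonneg hk.1
  obtain ⟨h1, h2, h3⟩ := le_inertialEnergy (y := x k - xbar k) (v := x k - x (k - 1))
    (by positivity : 0 < α / 2) hk.2.2.2.2.2.2.1 hk.2.2.2.2.1 hg
  refine ⟨hg, le_trans (by positivity) h1, h1, ?_, h3⟩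
  rw [one_mul]
  exact h2

/-- Rate of the energy: `s` is the exponent of the contraction, limited both by the damping
(`q ≤ s`) and by the strong convexity of the regularized objective (`p - q ≤ s`). -/
theorem energy_isBigO (h : InertialTikhonovScheme f α q c p xstar xbar x u) {s σ : ℝ}
    (hs : s < 1) (hqs : q ≤ s) (hps : p - q ≤ s) (h1 : 2 * q - p - 1 ≤ σ - s)
    (h2 : p - q - 2 ≤ σ - s) :
    schemeEnergy f α q c p xbar x =O[atTop] fun k : ℕ => (k : ℝ) ^ σ := by
  obtain ⟨C, hC0, hC⟩ := h.energy_estimate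
  have hα := h.α_pos
  have hc := h.c_pos
  set S₀ : ℝ := max 1 (1 / c) with hS₀
  have hS1 : 1 ≤ S₀ := le_max_left _ _
  have hS0 : 0 < S₀ := by linarith
  have hSc : 1 ≤ S₀ * c := by
    have := le_max_right 1 (1 / c)
    rwa [div_le_iff₀ hc] at this
  set b : ℝ := α / 2 / 4 with hb
  have hb0 : 0 < b := by positivity
  set L : ℝ := 8 * (1 + (α / 2) ^ 2) * S₀ with hL
  have hL0 : 0 < L := by positivity
  refine isBigO_rpow_of_contracting (κ := b / L) (C := 2 * C) (s := s) (by positivity)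
    (by positivity) hs (h.eventually_le_energy.mono fun k hk => hk.2.1) ?_
  filter_upwards [hC, h.eventually_parameters] with k hk hpar
  obtain ⟨hk2, hττ', hτ', -, -, -, hs2, -⟩ := hpar
  have hk1 : (1 : ℝ) ≤ k := by exact_mod_cast (by omega : 1 ≤ k)
  have hk0 : (0 : ℝ) < k := by linarith
  have hτ : 0 < (k : ℝ) ^ q := Real.rpow_pos_of_pos hk0 q
  have hγ := tikhonovCoeff_pos (p := p) hc (by omega : 1 ≤ k)
  have hγ' := tikhonovCoeff_pos (p := p) hc (by omega : 1 ≤ k + 1)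
  have hg' := h.regGap_nonneg (by omega : 2 ≤ k + 1)
  have hτ2 : ((k + 1 : ℕ) : ℝ) ^ q ≤ 2 * (k : ℝ) ^ q := by
    have h3 : 1 / (k : ℝ) ≤ 1 := by rw [div_le_one hk0]; exact hk1
    nlinarith
  have hSτ : (k : ℝ) ^ q ≤ S₀ * (k : ℝ) ^ s := by
    calc (k : ℝ) ^ q ≤ 1 * (k : ℝ) ^ s := by
          rw [one_mul]; exact Real.rpow_le_rpow_of_exponent_le hk1 hqs
      _ ≤ _ := by gcongr
  have hSγ : 1 ≤ S₀ * (k : ℝ) ^ s * ((k : ℝ) ^ q * tikhonovCoeff c p k) := by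
    have e : S₀ * (k : ℝ) ^ s * ((k : ℝ) ^ q * tikhonovCoeff c p k)
        = S₀ * c * (k : ℝ) ^ (s + q - p) := by
      rw [tikhonovCoeff_eq, sub_eq_add_neg, Real.rpow_add hk0, Real.rpow_add hk0]; ring
    have h3 : 1 ≤ (k : ℝ) ^ (s + q - p) := Real.one_le_rpow hk1 (by linarith)
    rw [e]
    nlinarith
  have hle := inertialEnergy_le (y := x (k + 1) - xbar (k + 1)) (v := x (k + 1) - x k)
    (by positivity : 0 < α / 2) hτ hττ' hτ2 hs2 hγ hγ'.le hg' hSτ hSγ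
  have hV : schemeEnergy f α q c p xbar x (k + 1)
      = inertialEnergy (α / 2) (((k + 1 : ℕ) : ℝ) ^ q) (tikhonovCoeff c p (k + 1))
        (regGap f c p xbar x (k + 1)) (x (k + 1) - xbar (k + 1)) (x (k + 1) - x k) := by
    rw [schemeEnergy, Nat.add_sub_cancel]
  rw [← hV] at hle
  set V' := schemeEnergy f α q c p xbar x (k + 1)
  set Δ := (k : ℝ) ^ q * regGap f c p xbar x (k + 1)
    + (k : ℝ) ^ q * tikhonovCoeff c p k * ‖x (k + 1) - xbar (k + 1)‖ ^ 2
    + (k : ℝ) ^ q * ‖x (k + 1) - x k‖ ^ 2 with hΔ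
  have hss : (k : ℝ) ^ (-s) * (k : ℝ) ^ s = 1 := by
    rw [← Real.rpow_add hk0]; simp
  have hdiss : b / L * (k : ℝ) ^ (-s) * V' ≤ b * Δ := by
    calc b / L * (k : ℝ) ^ (-s) * V'
        ≤ b / L * (k : ℝ) ^ (-s) * (8 * (1 + (α / 2) ^ 2) * (S₀ * (k : ℝ) ^ s) * Δ) := by gcongr
      _ = b / L * L * ((k : ℝ) ^ (-s) * (k : ℝ) ^ s) * Δ := by rw [hL]; ring
      _ = b * Δ := by rw [hss, div_mul_cancel₀ _ hL0.ne', mul_one]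
  have hw : 0 ≤ ((k : ℝ) ^ q) ^ 2 * ‖u (k + 1) + tikhonovCoeff c p k • x (k + 1)‖ ^ 2 := by
    positivity
  have hgpos : 0 ≤ b * ((k : ℝ) ^ q * regGap f c p xbar x (k + 1)) := by positivity
  have hα4 : α / 2 = 4 * b := by rw [hb]; ring
  have hΔle : b * Δ ≤ α / 2 * (k : ℝ) ^ q * regGap f c p xbar x (k + 1)
      + b * (k : ℝ) ^ q * tikhonovCoeff c p k * ‖x (k + 1) - xbar (k + 1)‖ ^ 2
      + b * (k : ℝ) ^ q * ‖x (k + 1) - x k‖ ^ 2 := by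
    rw [hΔ, hα4]
    linarith
  have hsrc : C * ((k : ℝ) ^ (2 * q - p - 1) + (k : ℝ) ^ (p - q - 2))
      ≤ 2 * C * (k : ℝ) ^ (σ - s) := by
    have r1 : (k : ℝ) ^ (2 * q - p - 1) ≤ (k : ℝ) ^ (σ - s) :=
      Real.rpow_le_rpow_of_exponent_le hk1 h1
    have r2 : (k : ℝ) ^ (p - q - 2) ≤ (k : ℝ) ^ (σ - s) :=
      Real.rpow_le_rpow_of_exponent_le hk1 h2
    calc _ ≤ C * ((k : ℝ) ^ (σ - s) + (k : ℝ) ^ (σ - s)) := by gcongr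
      _ = _ := by ring
  have : (1 + b / L * (k : ℝ) ^ (-s)) * V' = V' + b / L * (k : ℝ) ^ (-s) * V' := by ring
  linarith

lemma regGap_isBigO (h : InertialTikhonovScheme f α q c p xstar xbar x u) {σ e : ℝ}
    (hV : schemeEnergy f α q c p xbar x =O[atTop] fun k : ℕ => (k : ℝ) ^ σ)
    (he : σ - 2 * q = e) :
    regGap f c p xbar x =O[atTop] fun k : ℕ => (k : ℝ) ^ e :=
  he ▸ isBigO_rpow_of_weighted_le 1 (h.eventually_le_energy.mono fun _ hk => hk.1) hV
    (h.eventually_le_energy.mono fun _ hk => hk.2.2.2.1)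

lemma velocity_sq_isBigO (h : InertialTikhonovScheme f α q c p xstar xbar x u) {σ e : ℝ}
    (hV : schemeEnergy f α q c p xbar x =O[atTop] fun k : ℕ => (k : ℝ) ^ σ)
    (he : σ - 2 * q = e) :
    (fun n : ℕ => ‖x n - x (n - 1)‖ ^ 2) =O[atTop] fun k : ℕ => (k : ℝ) ^ e :=
  he ▸ isBigO_rpow_of_weighted_le 8 (Eventually.of_forall fun _ => by positivity) hV
    (h.eventually_le_energy.mono fun _ hk => hk.2.2.2.2)

lemma dist_isBigO_of_energy (h : InertialTikhonovScheme f α q c p xstar xbar x u) {σ e : ℝ}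
    (hV : schemeEnergy f α q c p xbar x =O[atTop] fun k : ℕ => (k : ℝ) ^ σ)
    (he : σ = e * 2) :
    (fun n : ℕ => ‖x n - xbar n‖) =O[atTop] fun k : ℕ => (k : ℝ) ^ e := by
  have hα := h.α_pos
  refine IsBigO.of_pow (n := 2) two_ne_zero ?_
  have h1 : (fun n : ℕ => ‖x n - xbar n‖ ^ 2) =O[atTop] schemeEnergy f α q c p xbar x := by
    refine IsBigO.of_bound (1 / (α / 2) ^ 2) ?_
    filter_upwards [h.eventually_le_energy] with k hk
    rw [Real.norm_of_nonneg (by positivity), Real.norm_of_nonneg hk.2.1, one_div_mul_eq_div,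
      le_div_iff₀ (by positivity), mul_comm]
    exact hk.2.2.1
  refine (h1.trans hV).congr (fun _ => rfl) fun k => ?_
  rw [he, Real.rpow_mul (Nat.cast_nonneg k), Real.rpow_two]
  rfl

lemma dist_isBigO_of_regGap (h : InertialTikhonovScheme f α q c p xstar xbar x u) {r e : ℝ}
    (hg : regGap f c p xbar x =O[atTop] fun k : ℕ => (k : ℝ) ^ r) (he : r + p = e * 2) :
    (fun n : ℕ => ‖x n - xbar n‖) =O[atTop] fun k : ℕ => (k : ℝ) ^ e := by
  have hc := h.c_pos
  refine IsBigO.of_pow (n := 2) two_ne_zero ?_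
  have h1 : (fun n : ℕ => ‖x n - xbar n‖ ^ 2) =O[atTop]
      fun k : ℕ => regGap f c p xbar x k * (k : ℝ) ^ p := by
    refine IsBigO.of_bound (2 / c) ?_
    filter_upwards [eventually_ge_atTop 2] with k hk
    have hk0 : (0 : ℝ) < k := by exact_mod_cast (by omega : 0 < k)
    have h2 := h.dist_sq_le_regGap hk
    have h3 := h.regGap_nonneg hk
    rw [Real.norm_of_nonneg (by positivity), Real.norm_of_nonneg (by positivity)]
    rw [tikhonovCoeff] at h2
    have hkp : 0 < (k : ℝ) ^ p := Real.rpow_pos_of_pos hk0 p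
    calc ‖x k - xbar k‖ ^ 2
        = 2 / c * ((c / (k : ℝ) ^ p / 2 * ‖x k - xbar k‖ ^ 2) * (k : ℝ) ^ p) := by field_simp
      _ ≤ _ := by gcongr
  have h2 := h1.trans (hg.mul (isBigO_refl (fun k : ℕ => (k : ℝ) ^ p) atTop))
  refine h2.congr' EventuallyEq.rfl ?_
  filter_upwards [eventually_ge_atTop 1] with k hk
  have hk0 : (0 : ℝ) < k := by exact_mod_cast hk
  rw [← Real.rpow_add hk0, he, Real.rpow_mul hk0.le, Real.rpow_two]
  rfl

lemma tendsto_of_dist_isBigO [CompleteSpace H]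
    (h : InertialTikhonovScheme f α q c p xstar xbar x u) {e : ℝ} (he : e < 0)
    (hd : (fun n : ℕ => ‖x n - xbar n‖) =O[atTop] fun k : ℕ => (k : ℝ) ^ e) :
    Tendsto x atTop (𝓝 xstar) := by
  have h1 : Tendsto (fun n => x n - xbar n) atTop (𝓝 0) :=
    tendsto_zero_iff_norm_tendsto_zero.2 (hd.trans_tendsto (tendsto_natCast_rpow_neg he))
  have h2 := tendsto_tikhonov_path h.convexLsc h.c_pos (by linarith [h.one_lt_p]) h.xstar_min
    h.xbar_min
  simpa using h1.add h2

lemma norm_sq_subgradient_le (γ : ℝ) (w z : H) :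
    ‖w‖ ^ 2 ≤ 2 * ‖w + γ • z‖ ^ 2 + 2 * (γ ^ 2 * ‖z‖ ^ 2) := by
  have h1 : ‖w‖ ≤ ‖w + γ • z‖ + ‖γ • z‖ := by
    have := norm_sub_le (w + γ • z) (γ • z)
    rwa [add_sub_cancel_right] at this
  have h2 : ‖γ • z‖ ^ 2 = γ ^ 2 * ‖z‖ ^ 2 := by
    rw [norm_smul, mul_pow, Real.norm_eq_abs, sq_abs]
  have h3 : ‖w‖ ^ 2 ≤ (‖w + γ • z‖ + ‖γ • z‖) ^ 2 := by gcongr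
  nlinarith [sq_nonneg (‖w + γ • z‖ - ‖γ • z‖)]

/-- Rate of the subgradients of the regularized objectives, read off from their contribution
`k ^ (2 q)` to the dissipation. -/
lemma regularized_subgradient_isBigO (h : InertialTikhonovScheme f α q c p xstar xbar x u)
    {σ : ℝ} (hV : schemeEnergy f α q c p xbar x =O[atTop] fun k : ℕ => (k : ℝ) ^ σ)
    (h1 : 2 * q - p - 1 ≤ σ) (h2 : p - q - 2 ≤ σ) :
    (fun k => ‖u (k + 1) + tikhonovCoeff c p k • x (k + 1)‖ ^ 2) =O[atTop]
      fun k : ℕ => (k : ℝ) ^ (σ - 2 * q) := by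
  obtain ⟨C, hC0, hC⟩ := h.energy_estimate
  have hα := h.α_pos
  have hc := h.c_pos
  have hsum : (fun k : ℕ => schemeEnergy f α q c p xbar x k
      + C * ((k : ℝ) ^ (2 * q - p - 1) + (k : ℝ) ^ (p - q - 2))) =O[atTop]
      fun k : ℕ => (k : ℝ) ^ σ :=
    hV.add (((isBigO_natCast_rpow h1).add (isBigO_natCast_rpow h2)).const_mul_left C)
  refine isBigO_rpow_of_weighted_le 1 (Eventually.of_forall fun _ => by positivity) hsum ?_
  filter_upwards [hC, (tendsto_add_atTop_nat 1).eventually h.eventually_le_energy,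
    eventually_ge_atTop 1] with k hk hV' hk1
  have hγ := tikhonovCoeff_pos (p := p) hc hk1
  have hg' := hV'.1
  have hE' := hV'.2.1
  have p1 : 0 ≤ α / 2 * (k : ℝ) ^ q * regGap f c p xbar x (k + 1) := by positivity
  have p2 : 0 ≤ α / 2 / 4 * (k : ℝ) ^ q * tikhonovCoeff c p k
    * ‖x (k + 1) - xbar (k + 1)‖ ^ 2 := by positivity
  have p3 : 0 ≤ α / 2 / 4 * (k : ℝ) ^ q * ‖x (k + 1) - x k‖ ^ 2 := by positivity
  linarith

lemma subgradient_isBigO (h : InertialTikhonovScheme f α q c p xstar xbar x u)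
    (hx : Tendsto x atTop (𝓝 xstar)) {σ e : ℝ}
    (hV : schemeEnergy f α q c p xbar x =O[atTop] fun k : ℕ => (k : ℝ) ^ σ)
    (h1 : 2 * q - p - 1 ≤ σ) (h2 : p - q - 2 ≤ σ) (he : σ - 2 * q = e) (hpe : -(2 * p) ≤ e) :
    (fun n : ℕ => ‖u n‖ ^ 2) =O[atTop] fun k : ℕ => (k : ℝ) ^ e := by
  refine isBigO_rpow_of_succ ?_
  have hw := h.regularized_subgradient_isBigO hV h1 h2
  rw [he] at hw
  have hb : (fun k => ‖x (k + 1)‖ ^ 2) =O[atTop] fun _ : ℕ => (1 : ℝ) :=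
    ((hx.comp (tendsto_add_atTop_nat 1)).norm.pow 2).isBigO_one ℝ
  have hγ : (fun k : ℕ => tikhonovCoeff c p k ^ 2) =O[atTop] fun k : ℕ => (k : ℝ) ^ e := by
    refine IsBigO.trans ?_ (isBigO_natCast_rpow hpe)
    refine isBigO_of_nonneg_le (c ^ 2) (Eventually.of_forall fun _ => by positivity)
      (Eventually.of_forall fun k => le_of_eq ?_) (fun _ => by positivity)
    rw [tikhonovCoeff_eq, mul_pow, ← Real.rpow_natCast ((k : ℝ) ^ (-p)),
      ← Real.rpow_mul (Nat.cast_nonneg k)]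
    congr 2; push_cast; ring
  have hprod := hγ.mul hb
  simp only [mul_one] at hprod
  have hsum := (hw.const_mul_left 2).add (hprod.const_mul_left 2)
  refine IsBigO.trans (IsBigO.of_bound 1 (Eventually.of_forall fun k => ?_)) hsum
  rw [Real.norm_of_nonneg (by positivity), Real.norm_of_nonneg (by positivity), one_mul]
  exact norm_sq_subgradient_le _ _ _

/-- Rate of the function values: the gap of the regularized objectives, or the regularization
itself, whichever is larger. -/
lemma value_isBigO (h : InertialTikhonovScheme f α q c p xstar xbar x u) {r e : ℝ}
    (hg : regGap f c p xbar x =O[atTop] fun k : ℕ => (k : ℝ) ^ r) (hre : r ≤ e) (hpe : -p ≤ e) :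
    (fun n : ℕ => (f (x n)).toReal - (f xstar).toReal) =O[atTop] fun k : ℕ => (k : ℝ) ^ e := by
  have hc := h.c_pos
  have hsum : (fun k : ℕ => regGap f c p xbar x k + c / 2 * ‖xstar‖ ^ 2 * (k : ℝ) ^ (-p))
      =O[atTop] fun k : ℕ => (k : ℝ) ^ e :=
    (hg.trans (isBigO_natCast_rpow hre)).add ((isBigO_natCast_rpow hpe).const_mul_left _)
  refine IsBigO.trans (IsBigO.of_bound 1 ?_) hsum
  filter_upwards [eventually_ge_atTop 2] with k hk
  have hxk := h.ne_top hk
  have hγ := tikhonovCoeff_pos (p := p) hc (by omega : 1 ≤ k)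
  have h1 := EReal.toReal_le_toReal (h.xstar_min.1 (x k)) (h.convexLsc.ne_bot _) hxk
  have h2 := h.quadratic_growth (by omega : 1 ≤ k) h.xstar_ne_top
  have h3 := h.regGap_nonneg hk
  have h4 : 0 ≤ tikhonovCoeff c p k / 2 * ‖xstar - xbar k‖ ^ 2 := by positivity
  have h5 : 0 ≤ tikhonovCoeff c p k / 2 * ‖x k‖ ^ 2 := by positivity
  have h6 : tikhonovCoeff c p k / 2 * ‖xstar‖ ^ 2 = c / 2 * ‖xstar‖ ^ 2 * (k : ℝ) ^ (-p) := by
    rw [tikhonovCoeff_eq]; ring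
  have hkp : 0 ≤ (k : ℝ) ^ (-p) := by positivity
  rw [Real.norm_of_nonneg (by linarith), Real.norm_of_nonneg (by positivity), one_mul]
  rw [h.regGap_eq hk]
  linarith

/-- When `p > 2 q` both sources of the energy estimate are summable, and so is the dissipation. -/
theorem summable_dissipation (h : InertialTikhonovScheme f α q c p xstar xbar x u)
    (hp : 2 * q < p) :
    Summable fun k : ℕ => α / 2 * (k : ℝ) ^ q * regGap f c p xbar x (k + 1)
      + α / 2 / 4 * (k : ℝ) ^ q * tikhonovCoeff c p k * ‖x (k + 1) - xbar (k + 1)‖ ^ 2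
      + α / 2 / 4 * (k : ℝ) ^ q * ‖x (k + 1) - x k‖ ^ 2
      + ((k : ℝ) ^ q) ^ 2 * ‖u (k + 1) + tikhonovCoeff c p k • x (k + 1)‖ ^ 2 := by
  obtain ⟨C, hC0, hC⟩ := h.energy_estimate
  have hα := h.α_pos
  have hpq := h.p_lt
  refine summable_of_energy_decrease (h.eventually_le_energy.mono fun k hk => hk.2.1) ?_
    (((Real.summable_nat_rpow.2 (by linarith)).add
      (Real.summable_nat_rpow.2 (by linarith))).mul_left C) hC
  filter_upwards [eventually_ge_atTop 1] with k hk
  have hγ := tikhonovCoeff_pos (p := p) h.c_pos hk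
  have hg := h.regGap_nonneg (by omega : 2 ≤ k + 1)
  positivity

theorem summable_estimates (h : InertialTikhonovScheme f α q c p xstar xbar x u)
    (hx : Tendsto x atTop (𝓝 xstar)) (hp : 2 * q < p) :
    (Summable fun k : ℕ => ((k + 1 : ℕ) : ℝ) ^ q * regGap f c p xbar x (k + 1)) ∧
      (Summable fun k : ℕ => ((k + 1 : ℕ) : ℝ) ^ (2 * q) * ‖u (k + 1)‖ ^ 2) ∧
      (Summable fun k : ℕ => (k : ℝ) ^ q * ‖x (k + 1) - x k‖ ^ 2) := by
  have hα := h.α_pos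
  have hc := h.c_pos
  have hp1 := h.one_lt_p
  have hD := h.summable_dissipation hp
  set D : ℕ → ℝ := fun k : ℕ => α / 2 * (k : ℝ) ^ q * regGap f c p xbar x (k + 1)
      + α / 2 / 4 * (k : ℝ) ^ q * tikhonovCoeff c p k * ‖x (k + 1) - xbar (k + 1)‖ ^ 2
      + α / 2 / 4 * (k : ℝ) ^ q * ‖x (k + 1) - x k‖ ^ 2
      + ((k : ℝ) ^ q) ^ 2 * ‖u (k + 1) + tikhonovCoeff c p k • x (k + 1)‖ ^ 2 with hDdef
  have hparts : ∀ᶠ k : ℕ in atTop, 0 ≤ regGap f c p xbar x (k + 1) ∧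
      ((k + 1 : ℕ) : ℝ) ^ q ≤ 2 * (k : ℝ) ^ q ∧
      α / 2 * ((k : ℝ) ^ q * regGap f c p xbar x (k + 1)) ≤ D k ∧
      α / 2 / 4 * ((k : ℝ) ^ q * ‖x (k + 1) - x k‖ ^ 2) ≤ D k ∧
      ((k : ℝ) ^ q) ^ 2 * ‖u (k + 1) + tikhonovCoeff c p k • x (k + 1)‖ ^ 2 ≤ D k := by
    filter_upwards [h.eventually_parameters] with k hk
    have hk1 : (1 : ℝ) ≤ k := by exact_mod_cast (by omega : 1 ≤ k)
    have hk0 : (0 : ℝ) < k := by linarith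
    have hγ := tikhonovCoeff_pos (p := p) hc (by omega : 1 ≤ k)
    have hg := h.regGap_nonneg (by omega : 2 ≤ k + 1)
    have p1 : 0 ≤ α / 2 * ((k : ℝ) ^ q * regGap f c p xbar x (k + 1)) := by positivity
    have p2 : 0 ≤ α / 2 / 4 * (k : ℝ) ^ q * tikhonovCoeff c p k
      * ‖x (k + 1) - xbar (k + 1)‖ ^ 2 := by positivity
    have p3 : 0 ≤ α / 2 / 4 * ((k : ℝ) ^ q * ‖x (k + 1) - x k‖ ^ 2) := by positivity
    have p4 : 0 ≤ ((k : ℝ) ^ q) ^ 2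
      * ‖u (k + 1) + tikhonovCoeff c p k • x (k + 1)‖ ^ 2 := by positivity
    have hτ2 : ((k + 1 : ℕ) : ℝ) ^ q ≤ 2 * (k : ℝ) ^ q := by
      have h3 : 1 / (k : ℝ) ≤ 1 := by rw [div_le_one hk0]; exact hk1
      have h4 := hk.2.2.1
      have h5 : 0 ≤ (k : ℝ) ^ q := by positivity
      nlinarith
    simp only [hDdef]
    refine ⟨hg, hτ2, ?_, ?_, ?_⟩ <;> linarith
  refine ⟨?_, ?_, ?_⟩
  · refine (hD.mul_left (4 / α)).of_norm_bounded_eventually_nat ?_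
    filter_upwards [hparts] with k hk
    obtain ⟨hg, hτ2, hk3, -, -⟩ := hk
    rw [Real.norm_of_nonneg (by positivity)]
    calc _ ≤ 2 * (k : ℝ) ^ q * regGap f c p xbar x (k + 1) := by gcongr
      _ = 4 / α * (α / 2 * ((k : ℝ) ^ q * regGap f c p xbar x (k + 1))) := by field_simp; ring
      _ ≤ _ := by gcongr
  · have hbd : ∀ᶠ k : ℕ in atTop, ‖x (k + 1)‖ ^ 2 ≤ (‖xstar‖ + 1) ^ 2 := by
      have h1 := (hx.comp (tendsto_add_atTop_nat 1)).norm.eventually_le_const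
        (lt_add_one ‖xstar‖)
      filter_upwards [h1] with k hk
      have : ‖x (k + 1)‖ ≤ ‖xstar‖ + 1 := hk
      gcongr
    have hS : Summable fun k : ℕ => (k : ℝ) ^ (2 * q - 2 * p) :=
      Real.summable_nat_rpow.2 (by linarith)
    refine ((hD.mul_left 8).add (hS.mul_left (8 * c ^ 2 * (‖xstar‖ + 1) ^ 2))
      ).of_norm_bounded_eventually_nat ?_
    filter_upwards [hparts, hbd, eventually_ge_atTop 1] with k hk hb hk1
    obtain ⟨-, hτ2, -, -, hk5⟩ := hk
    have hk0 : (0 : ℝ) < k := by exact_mod_cast hk1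
    rw [Real.norm_of_nonneg (by positivity)]
    have e1 : ((k + 1 : ℕ) : ℝ) ^ (2 * q) ≤ 4 * ((k : ℝ) ^ q) ^ 2 := by
      rw [mul_comm 2 q, Real.rpow_mul (Nat.cast_nonneg _), Real.rpow_two]
      calc _ ≤ (2 * (k : ℝ) ^ q) ^ 2 := by gcongr
        _ = _ := by ring
    have e2 : ((k : ℝ) ^ q) ^ 2 * tikhonovCoeff c p k ^ 2
        = c ^ 2 * (k : ℝ) ^ (2 * q - 2 * p) := by
      rw [tikhonovCoeff_eq, show 2 * q - 2 * p = (q + -p) * 2 by ring,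
        Real.rpow_mul hk0.le, Real.rpow_two, Real.rpow_add hk0]
      ring
    calc _ ≤ 4 * ((k : ℝ) ^ q) ^ 2 * (2 * ‖u (k + 1) + tikhonovCoeff c p k • x (k + 1)‖ ^ 2
          + 2 * (tikhonovCoeff c p k ^ 2 * (‖xstar‖ + 1) ^ 2)) := by
          gcongr
          refine (norm_sq_subgradient_le (tikhonovCoeff c p k) _ (x (k + 1))).trans ?_
          gcongr
      _ = 8 * (((k : ℝ) ^ q) ^ 2 * ‖u (k + 1) + tikhonovCoeff c p k • x (k + 1)‖ ^ 2)
          + 8 * (((k : ℝ) ^ q) ^ 2 * tikhonovCoeff c p k ^ 2) * (‖xstar‖ + 1) ^ 2 := by ring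
      _ ≤ 8 * D k + 8 * (c ^ 2 * (k : ℝ) ^ (2 * q - 2 * p)) * (‖xstar‖ + 1) ^ 2 := by
          rw [e2]; gcongr
      _ = _ := by ring
  · refine (hD.mul_left (8 / α)).of_norm_bounded_eventually_nat ?_
    filter_upwards [hparts] with k hk
    rw [Real.norm_of_nonneg (by positivity)]
    calc _ = 8 / α * (α / 2 / 4 * ((k : ℝ) ^ q * ‖x (k + 1) - x k‖ ^ 2)) := by
          field_simp; ring
      _ ≤ _ := by gcongr; exact hk.2.2.2.1

end InertialTikhonovScheme

end

/-! ### The convergence theorem -/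

theorem theorem3p3 {H : Type*} [NormedAddCommGroup H] [InnerProductSpace ℝ H] [CompleteSpace H]
    (f : H → EReal) (hf : ProperConvexLsc f)
    (α q c p : ℝ) (hα : 0 < α) (hc : 0 < c) (hq0 : 0 < q) (hq1 : q < 1)
    (hp1 : 1 < p) (hpq : p < q + 1)
    -- the minimum-norm minimizer of `f`; in particular `f` has a minimizer
    (xstar : H) (hxstar : IsMinNormMinimizer f xstar)
    -- the minimizer of the regularized objective, for every index
    (xbar : ℕ → H) (hxbar : ∀ k : ℕ, 1 ≤ k → xbar k ∈ argminSet (tikhonovReg f c p k))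
    (x : ℕ → H) (hx : IsPIATR f α q c p (fun _ => 1) x)
    (u : ℕ → H)
    (hu : ∀ k : ℕ, 2 ≤ k →
      x k = inertialCoeff α q (k - 1) • (x (k - 1) - x (k - 2)) - u k
        + (1 - tikhonovCoeff c p (k - 1)) • x (k - 1)) :
    -- from index 2 on, function values are finite and `u k` is a subgradient
    (∀ k : ℕ, 2 ≤ k → f (x k) ≠ ⊤ ∧ u k ∈ subdiff f (x k)) ∧
    Tendsto x atTop (𝓝 xstar) ∧
    -- first regime
    (p ≤ 2 * q →
      ((fun n : ℕ => ‖x n - xbar n‖) =O[atTop] fun n : ℕ => (n : ℝ) ^ ((q - 1) / 2)) ∧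
      ((fun n : ℕ => ‖x n - x (n - 1)‖ ^ 2) =O[atTop] fun n : ℕ => (n : ℝ) ^ (q - p - 1)) ∧
      ((fun n : ℕ => ‖u n‖ ^ 2) =O[atTop] fun n : ℕ => (n : ℝ) ^ (q - p - 1)) ∧
      ((fun n : ℕ => (f (x n)).toReal - (f xstar).toReal) =O[atTop]
        fun n : ℕ => (n : ℝ) ^ (-p))) ∧
    -- second regime
    (2 * q < p → p ≤ (3 * q + 1) / 2 →
      ((fun n : ℕ => ‖x n - xbar n‖) =O[atTop] fun n : ℕ => (n : ℝ) ^ ((q - 1) / 2)) ∧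
      ((fun n : ℕ => (tikhonovReg f c p n (x n)).toReal - (tikhonovReg f c p n (xbar n)).toReal)
        =O[atTop] fun n : ℕ => (n : ℝ) ^ (-q - 1)) ∧
      ((fun n : ℕ => ‖x n - x (n - 1)‖ ^ 2) =O[atTop] fun n : ℕ => (n : ℝ) ^ (-q - 1)) ∧
      ((fun n : ℕ => ‖u n‖ ^ 2) =O[atTop] fun n : ℕ => (n : ℝ) ^ (-q - 1)) ∧
      ((fun n : ℕ => (f (x n)).toReal - (f xstar).toReal) =O[atTop]
        fun n : ℕ => (n : ℝ) ^ (-p))) ∧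
    -- third regime
    ((3 * q + 1) / 2 < p →
      ((fun n : ℕ => ‖x n - xbar n‖) =O[atTop] fun n : ℕ => (n : ℝ) ^ (p - q - 1)) ∧
      ((fun n : ℕ => (tikhonovReg f c p n (x n)).toReal - (tikhonovReg f c p n (xbar n)).toReal)
        =O[atTop] fun n : ℕ => (n : ℝ) ^ (2 * p - 4 * q - 2)) ∧
      ((fun n : ℕ => ‖x n - x (n - 1)‖ ^ 2) =O[atTop]
        fun n : ℕ => (n : ℝ) ^ (2 * p - 4 * q - 2)) ∧
      ((fun n : ℕ => ‖u n‖ ^ 2) =O[atTop] fun n : ℕ => (n : ℝ) ^ (2 * p - 4 * q - 2)) ∧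
      (p < (4 * q + 2) / 3 →
        (fun n : ℕ => (f (x n)).toReal - (f xstar).toReal) =O[atTop]
          fun n : ℕ => (n : ℝ) ^ (-p)) ∧
      ((4 * q + 2) / 3 ≤ p →
        (fun n : ℕ => (f (x n)).toReal - (f xstar).toReal) =O[atTop]
          fun n : ℕ => (n : ℝ) ^ (2 * p - 4 * q - 2))) ∧
    -- sum estimates in the second and third regimes
    (2 * q < p →
      (Summable fun j : ℕ => ((j + 2 : ℕ) : ℝ) ^ q *
        ((tikhonovReg f c p (j + 2) (x (j + 2))).toReal
          - (tikhonovReg f c p (j + 2) (xbar (j + 2))).toReal)) ∧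
      (Summable fun j : ℕ => ((j + 2 : ℕ) : ℝ) ^ (2 * q) * ‖u (j + 2)‖ ^ 2) ∧
      (Summable fun j : ℕ => ((j + 1 : ℕ) : ℝ) ^ q * ‖x (j + 2) - x (j + 1)‖ ^ 2)) := by
  have h : InertialTikhonovScheme f α q c p xstar xbar x u :=
    ⟨hf, hα, hc, hq0, hq1, hp1, hpq, hxstar, hxbar, hx, hu⟩
  have E1 : p ≤ 2 * q → schemeEnergy f α q c p xbar x =O[atTop]
      fun k : ℕ => (k : ℝ) ^ (3 * q - p - 1) := fun hp =>
    h.energy_isBigO (s := q) hq1 le_rfl (by linarith) (by linarith) (by linarith)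
  have E2 : 2 * q < p → p ≤ (3 * q + 1) / 2 → schemeEnergy f α q c p xbar x =O[atTop]
      fun k : ℕ => (k : ℝ) ^ (q - 1) := fun hp hp' =>
    h.energy_isBigO (s := p - q) (by linarith) (by linarith) le_rfl (by linarith) (by linarith)
  have E3 : (3 * q + 1) / 2 < p → schemeEnergy f α q c p xbar x =O[atTop]
      fun k : ℕ => (k : ℝ) ^ (2 * p - 2 * q - 2) := fun hp =>
    h.energy_isBigO (s := p - q) (by linarith) (by linarith) le_rfl (by linarith) (by linarith)
  have D1 : p ≤ 2 * q → (fun n : ℕ => ‖x n - xbar n‖) =O[atTop]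
      fun n : ℕ => (n : ℝ) ^ ((q - 1) / 2) := fun hp =>
    h.dist_isBigO_of_regGap (h.regGap_isBigO (E1 hp) rfl) (by ring)
  have D2 : 2 * q < p → p ≤ (3 * q + 1) / 2 → (fun n : ℕ => ‖x n - xbar n‖) =O[atTop]
      fun n : ℕ => (n : ℝ) ^ ((q - 1) / 2) := fun hp hp' =>
    h.dist_isBigO_of_energy (E2 hp hp') (by ring)
  have D3 : (3 * q + 1) / 2 < p → (fun n : ℕ => ‖x n - xbar n‖) =O[atTop]
      fun n : ℕ => (n : ℝ) ^ (p - q - 1) := fun hp =>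
    h.dist_isBigO_of_energy (E3 hp) (by ring)
  have hlim : Tendsto x atTop (𝓝 xstar) := by
    rcases le_or_gt p (2 * q) with hp | hp
    · exact h.tendsto_of_dist_isBigO (by linarith) (D1 hp)
    rcases le_or_gt p ((3 * q + 1) / 2) with hp' | hp'
    · exact h.tendsto_of_dist_isBigO (by linarith) (D2 hp hp')
    · exact h.tendsto_of_dist_isBigO (by linarith) (D3 hp')
  refine ⟨fun k hk => h.mem_subdiff hk, hlim, fun hp => ?_, fun hp hp' => ?_, fun hp => ?_,
    fun hp => ?_⟩
  · have hg := h.regGap_isBigO (e := q - p - 1) (E1 hp) (by ring)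
    exact ⟨D1 hp, h.velocity_sq_isBigO (E1 hp) (by ring),
      h.subgradient_isBigO hlim (E1 hp) (by linarith) (by linarith) (by ring) (by linarith),
      h.value_isBigO hg (by linarith) le_rfl⟩
  · have hg := h.regGap_isBigO (e := -q - 1) (E2 hp hp') (by ring)
    exact ⟨D2 hp hp', hg, h.velocity_sq_isBigO (E2 hp hp') (by ring),
      h.subgradient_isBigO hlim (E2 hp hp') (by linarith) (by linarith) (by ring) (by linarith),
      h.value_isBigO hg (by linarith) le_rfl⟩
  · have hg := h.regGap_isBigO (e := 2 * p - 4 * q - 2) (E3 hp) (by ring)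
    exact ⟨D3 hp, hg, h.velocity_sq_isBigO (E3 hp) (by ring),
      h.subgradient_isBigO hlim (E3 hp) (by linarith) (by linarith) (by ring) (by linarith),
      fun hp' => h.value_isBigO hg (by linarith) le_rfl,
      fun hp' => h.value_isBigO hg le_rfl (by linarith)⟩
  · obtain ⟨s1, s2, s3⟩ := h.summable_estimates hlim hp
    rw [← summable_nat_add_iff 1] at s1 s2 s3
    simp only [add_assoc, Nat.reduceAdd] at s1 s2 s3
    exact ⟨s1, s2, s3⟩
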